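/- Let $\mathcal L$ be a finite distributive lattice with least element $0$ and greatest element $1$, $0\neq 1$, regarded as a Heyting algebra, and for $\ell,x\in\mathcal L$ put $T_\ell(x)=1$ if $x=\ell$ and $T_\ell(x)=0$ otherwise. **Algebras.** An $\mathcal L$-$\mathcal{VL}$-algebra is a Heyting algebra $(\mathcal A,\wedge,\vee,\rightarrow,0,1)$ with unary operations $T_\ell$ ($\ell\in\mathcal L$) such that for all $a,b\in\mathcal A$ and $\ell,\ell_1,\ell_2\in\mathcal L$: (i) $T_{\ell_1}(a)\wedge T_{\ell_2}(b)\le T_{\ell_1\rightarrow\ell_2}(a\rightarrow b)\wedge T_{\ell_1\wedge\ell_2}(a\wedge b)\wedge T_{\ell_1\vee\ell_2}(a\vee b)$ and $T_{\ell_2}(a)\le T_{T_{\ell_1}(\ell_2)}(T_{\ell_1}(a))$; (ii) $T_0(0)=1$, $T_\ell(0)=0$ for $\ell\ne0$, $T_1(1)=1$, $T_\ell(1)=0$ for $\ell\neq1$; (iii) $\bigvee_{\ell\in\mathcal L}T_\ell(a)=1$, $T_\ell(a)\vee(T_\ell(a)\rightarrow0)=1$, and $T_{\ell_1}(a)\wedge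 T_{\ell_2}(a)=0$ for $\ell_1\ne\ell_2$; (iv) $T_1(T_\ell(a))=T_\ell(a)$, $T_0(T_\ell(a))=T_\ell(a)\rightarrow0$, and $T_{\ell_2}(T_{\ell_1}(a))=0$ for $\ell_2\ne0,1$; (v) $T_1(a)\le a$ and $T_1(a\wedge b)=T_1(a)\wedge T_1(b)$; (vi) $\bigwedge_{\ell\in\mathcal L}(T_\ell(a)\leftrightarrow T_\ell(b))\le(a\leftrightarrow b)$. An $\mathcal L$-$\mathcal{ML}$-algebra (algebra of Fitting's Heyting-valued modal logic) is an $\mathcal L$-$\mathcal{VL}$-algebra with a unary operation $\Box$ such that $\Box(a\wedge b)=\Box a\wedge\Box b$ and $\Box U_\ell(a)=U_\ell(\Box a)$ for all $a,b\in\mathcal A$, $\ell\in\mathcal L$, where $U_\ell(a)=\bigvee\{T_{\ell'}(a):\ell\le\ell'\in\mathcal L\}$. $\mathcal{MA}_{\mathcal L}$ is the category of $\mathcal L$-$\mathcal{ML}$-algebras and the maps preserving all the operations $\wedge,\vee,\rightarrow,0,1,T_\ell,\Box$. **Spaces.** For a set $X$ with two topologies $\tau_1,\tau_2$ let $\beta_1$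 be the family of $\tau_1$-open $\tau_2$-closed sets and $\beta_2$ the family of $\tau_2$-open $\tau_1$-closed sets. $(X,\tau_1,\tau_2)$ is a pairwise Boolean space if for every ordered pair $(x,y)$ of distinct points there are disjoint $U\in\tau_1$, $V\in\tau_2$ with $x\in U$, $y\in V$; $\beta_i$ is a basis of $\tau_i$ for $i=1,2$; and the topology generated by $\tau_1\cup\tau_2$ is compact. A subset is pairwise closed if it is closed in both topologies, and a map is pairwise continuous if it is continuous for the first topologies and for the second topologies. Let $\mathfrak S_{\mathcal L}$ be the set of subalgebras of $(\mathcal L,\wedge,\vee,\rightarrow,T_\ell,0,1)$. An object of $PBS_{\mathcal L}$ is a pairwise Boolean space $X$ together with a map $\alpha_X$ from $\mathfrak S_{\mathcal L}$ to the pairwise closed subsets of $X$ with $\alpha_X(\mathcal L)=X$ and $\alpha_X(\mathcal L_2\cap\mathcal L_3)=\alpha_X(\mathcal L_2)\cap\alpha_X(\mathcal L_3)$; an arrow is a pairwise continuous map $f:X\to Y$ with $f(\alpha_X(\mathcal L_1))\subseteq\alpha_Y(\mathcal L_1)$ for all $\mathcal L_1\in\mathfrak S_{\mathcal L}$. **The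 functor.** The $\mathcal L$-biVietoris functor $V_{\mathcal L}^{bi}:PBS_{\mathcal L}\to PBS_{\mathcal L}$ sends $(X,\tau_1,\tau_2,\alpha_X)$ to the set $\mathcal K(X)$ of all pairwise closed subsets of $X$ (including $\emptyset$) with the topologies $\tau_i^V$ ($i=1,2$) generated by the sets $\{C\in\mathcal K(X):C\subseteq U\}$ and $\{C\in\mathcal K(X):C\cap U\ne\emptyset\}$, $U\in\beta_i$, and with $\mathcal L_1\mapsto\{C\in\mathcal K(X):C\subseteq\alpha_X(\mathcal L_1)\}$; it sends an arrow $f$ to $K\mapsto f[K]$. $COALG(V_{\mathcal L}^{bi})$ is the category of coalgebras $\xi:X\to V_{\mathcal L}^{bi}(X)$; its morphisms $(X_1,\xi_1)\to(X_2,\xi_2)$ are the arrows $f:X_1\to X_2$ of $PBS_{\mathcal L}$ with $\xi_2\circ f=V_{\mathcal L}^{bi}(f)\circ\xi_1$. **Theorem.** The categories $\mathcal{MA}_{\mathcal L}$ and $COALG(V_{\mathcal L}^{bi})$ are dually equivalent, i.e. the opposite category of $\mathcal{MA}_{\mathcal L}$ is equivalent to $COALG(V_{\mathcal L}^{bi})$.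 -/

import Mathlib

open CategoryTheory
open scoped Topology

universe u

namespace FittingDuality

/-! ### Algebras of Fitting's Heyting-valued (modal) logic -/

section Algebra

variable {L : Type u} [HeytingAlgebra L]

open Classical in
/-- The unary operation `T_ℓ` on the truth value algebra `L` itself. -/
noncomputable def truthT (l x : L) : L := if x = l then ⊤ else ⊥

/-- The operation `U_ℓ(a) = ⋁ {T_ℓ'(a) : ℓ ≤ ℓ'}` derived from a family `T` of unary operations. -/
noncomputable def opU {A : Type u} [Fintype L] [HeytingAlgebra A] (T : L → A → A) (l : L) (a : A) :
    A :=
  open Classical in (Finset.univ.filter (fun l' : L => l ≤ l')).sup (fun l' => T l' a)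

/-- The axioms of `L`-`VL`-algebras, for a Heyting algebra `A` with unary operations
`T l`, `l ∈ L`. -/
structure IsVLAlgebra (L : Type u) [HeytingAlgebra L] [Fintype L] {A : Type u} [HeytingAlgebra A]
    (T : L → A → A) : Prop where
  T_himp : ∀ (l₁ l₂ : L) (a b : A), T l₁ a ⊓ T l₂ b ≤ T (l₁ ⇨ l₂) (a ⇨ b)
  T_inf : ∀ (l₁ l₂ : L) (a b : A), T l₁ a ⊓ T l₂ b ≤ T (l₁ ⊓ l₂) (a ⊓ b)
  T_sup : ∀ (l₁ l₂ : L) (a b : A), T l₁ a ⊓ T l₂ b ≤ T (l₁ ⊔ l₂) (a ⊔ b)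
  T_T : ∀ (l₁ l₂ : L) (a : A), T l₂ a ≤ T (truthT l₁ l₂) (T l₁ a)
  T_bot_bot : T ⊥ ⊥ = ⊤
  T_bot : ∀ l : L, l ≠ ⊥ → T l ⊥ = ⊥
  T_top_top : T ⊤ ⊤ = ⊤
  T_top : ∀ l : L, l ≠ ⊤ → T l ⊤ = ⊥
  T_cover : ∀ a : A, Finset.univ.sup (fun l : L => T l a) = ⊤
  T_em : ∀ (l : L) (a : A), T l a ⊔ (T l a ⇨ ⊥) = ⊤
  T_disjoint : ∀ (l₁ l₂ : L) (a : A), l₁ ≠ l₂ → T l₁ a ⊓ T l₂ a = ⊥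
  T_top_T : ∀ (l : L) (a : A), T ⊤ (T l a) = T l a
  T_bot_T : ∀ (l : L) (a : A), T ⊥ (T l a) = T l a ⇨ ⊥
  T_mid_T : ∀ (l₁ l₂ : L) (a : A), l₂ ≠ ⊥ → l₂ ≠ ⊤ → T l₂ (T l₁ a) = ⊥
  T_top_le : ∀ a : A, T ⊤ a ≤ a
  T_top_inf : ∀ a b : A, T ⊤ (a ⊓ b) = T ⊤ a ⊓ T ⊤ b
  T_ext : ∀ a b : A, Finset.univ.inf (fun l : L => bihimp (T l a) (T l b)) ≤ bihimp a b

/-- `L`-`ML`-algebras. -/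
structure MLAlg (L : Type u) [HeytingAlgebra L] [Fintype L] where
  carrier : Type u
  [heyting : HeytingAlgebra carrier]
  T : L → carrier → carrier
  isVLAlgebra : IsVLAlgebra L T
  box : carrier → carrier
  box_inf : ∀ a b : carrier, box (a ⊓ b) = box a ⊓ box b
  box_U : ∀ (l : L) (a : carrier), box (opU T l a) = opU T l (box a)

attribute [instance] MLAlg.heyting

/-- Homomorphisms of `L`-`ML`-algebras: maps preserving `⊔`, `⊓`, `⇨`, `⊥` (hence also
`⊤ = ⊥ ⇨ ⊥`), all `T l`, and `□`. -/
@[ext]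
structure MLHom {L : Type u} [HeytingAlgebra L] [Fintype L] (A B : MLAlg L) where
  toHeytingHom : HeytingHom A.carrier B.carrier
  map_T : ∀ (l : L) (a : A.carrier), toHeytingHom (A.T l a) = B.T l (toHeytingHom a)
  map_box : ∀ a : A.carrier, toHeytingHom (A.box a) = B.box (toHeytingHom a)

/-- The category of `L`-`ML`-algebras and their homomorphisms. -/
instance (L : Type u) [HeytingAlgebra L] [Fintype L] : Category (MLAlg L) where
  Hom A B := MLHom A B
  id A := ⟨HeytingHom.id _, fun _ _ => rfl, fun _ => rfl⟩
  comp f g := ⟨g.toHeytingHom.comp f.toHeytingHom,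
    fun l a => by simp [f.map_T, g.map_T], fun a => by simp [f.map_box, g.map_box]⟩

/-- Subalgebras of `(L, ⊓, ⊔, ⇨, T_ℓ (ℓ ∈ L), ⊥, ⊤)`. -/
@[ext]
structure SubAlg (L : Type u) [HeytingAlgebra L] where
  carrier : Set L
  bot_mem : ⊥ ∈ carrier
  top_mem : ⊤ ∈ carrier
  inf_mem : ∀ {a b : L}, a ∈ carrier → b ∈ carrier → a ⊓ b ∈ carrier
  sup_mem : ∀ {a b : L}, a ∈ carrier → b ∈ carrier → a ⊔ b ∈ carrier
  himp_mem : ∀ {a b : L}, a ∈ carrier → b ∈ carrier → a ⇨ b ∈ carrier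
  T_mem : ∀ (l : L) {a : L}, a ∈ carrier → truthT l a ∈ carrier

/-- The greatest subalgebra, `L` itself. -/
instance : Top (SubAlg L) :=
  ⟨⟨Set.univ, trivial, trivial, fun _ _ => trivial, fun _ _ => trivial, fun _ _ => trivial,
    fun _ _ _ => trivial⟩⟩

/-- The meet of two subalgebras is their intersection. -/
instance : Min (SubAlg L) :=
  ⟨fun M N => ⟨M.carrier ∩ N.carrier, ⟨M.bot_mem, N.bot_mem⟩, ⟨M.top_mem, N.top_mem⟩,
    fun ha hb => ⟨M.inf_mem ha.1 hb.1, N.inf_mem ha.2 hb.2⟩,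
    fun ha hb => ⟨M.sup_mem ha.1 hb.1, N.sup_mem ha.2 hb.2⟩,
    fun ha hb => ⟨M.himp_mem ha.1 hb.1, N.himp_mem ha.2 hb.2⟩,
    fun l _ ha => ⟨M.T_mem l ha.1, N.T_mem l ha.2⟩⟩⟩

end Algebra

/-! ### Bitopological spaces -/

section Bitopology

variable {X : Type u}

/-- `bβ τ₁ τ₂` is the family of `τ₁`-open and `τ₂`-closed sets. Thus `β₁ = bβ τ₁ τ₂`
and `β₂ = bβ τ₂ τ₁`. -/
def bβ (τ₁ τ₂ : TopologicalSpace X) : Set (Set X) := {U | IsOpen[τ₁] U ∧ IsClosed[τ₂] U}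

theorem preimage_mem_bβ {Y : Type u} {σ₁ σ₂ : TopologicalSpace X} {τ₁ τ₂ : TopologicalSpace Y}
    {f : X → Y} (h₁ : Continuous[σ₁, τ₁] f) (h₂ : Continuous[σ₂, τ₂] f) {U : Set Y}
    (hU : U ∈ bβ τ₁ τ₂) : f ⁻¹' U ∈ bβ σ₁ σ₂ :=
  ⟨@IsOpen.preimage _ _ σ₁ τ₁ _ h₁ _ hU.1, @IsClosed.preimage _ _ σ₂ τ₂ _ h₂ _ hU.2⟩

/-- A set is pairwise closed if it is closed for both topologies. -/
def PairwiseClosed (τ₁ τ₂ : TopologicalSpace X) (C : Set X) : Prop :=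
  IsClosed[τ₁] C ∧ IsClosed[τ₂] C

/-- Pairwise Boolean spaces. The pairwise Hausdorff condition concerns every *ordered* pair
of distinct points. In Mathlib's order on topologies `τ₁ ⊓ τ₂` is the topology generated by
`τ₁ ∪ τ₂`, i.e. the join `τ₁ ∨ τ₂` of the families of open sets. -/
structure PairwiseBoolean (τ₁ τ₂ : TopologicalSpace X) : Prop where
  hausdorff : ∀ x y : X, x ≠ y →
    ∃ U V : Set X, IsOpen[τ₁] U ∧ IsOpen[τ₂] V ∧ x ∈ U ∧ y ∈ V ∧ Disjoint U V
  zeroDim₁ : @TopologicalSpace.IsTopologicalBasis X τ₁ (bβ τ₁ τ₂)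
  zeroDim₂ : @TopologicalSpace.IsTopologicalBasis X τ₂ (bβ τ₂ τ₁)
  compact : @CompactSpace X (τ₁ ⊓ τ₂)

/-- In a pairwise Boolean space every member of `β₂` is `τ₁`-open. -/
theorem PairwiseBoolean.isOpen_of_mem {τ₁ τ₂ : TopologicalSpace X} (h : PairwiseBoolean τ₁ τ₂)
    {U : Set X} (hU : U ∈ bβ τ₂ τ₁) : IsOpen[τ₁] U := by
  have hle₁ : τ₁ ⊓ τ₂ ≤ τ₁ := inf_le_left
  have hle₂ : τ₁ ⊓ τ₂ ≤ τ₂ := inf_le_right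
  have hcomp : @IsCompact X (τ₁ ⊓ τ₂) Uᶜ := by
    let := τ₁ ⊓ τ₂
    have := h.compact
    exact IsClosed.isCompact ((hU.1.mono hle₂).isClosed_compl)
  rw [@isOpen_iff_forall_mem_open X τ₁ U]
  intro x hx
  have hsep : ∀ y : (Uᶜ : Set X), ∃ W V : Set X, IsOpen[τ₁] W ∧ IsOpen[τ₂] V ∧ x ∈ W ∧
      (y : X) ∈ V ∧ Disjoint W V :=
    fun y => h.hausdorff x y (fun e => y.2 (e ▸ hx))
  choose W V hW hV hxW hyV hd using hsep
  obtain ⟨s, hs⟩ := @IsCompact.elim_finite_subcover X (τ₁ ⊓ τ₂) _ _ hcomp V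
    (fun y => (hV y).mono hle₂) (fun y hy => Set.mem_iUnion.2 ⟨⟨y, hy⟩, hyV ⟨y, hy⟩⟩)
  refine ⟨⋂ i ∈ s, W i, ?_, ?_, ?_⟩
  · intro z hz
    by_contra hzU
    obtain ⟨i, hi, hzi⟩ := Set.mem_iUnion₂.1 (hs hzU)
    exact Set.disjoint_left.1 (hd i) (Set.mem_iInter₂.1 hz i hi) hzi
  · let := τ₁
    exact isOpen_biInter_finset (fun i _ => hW i)
  · exact Set.mem_iInter₂.2 (fun i _ => hxW i)

theorem PairwiseBoolean.symm {τ₁ τ₂ : TopologicalSpace X} (h : PairwiseBoolean τ₁ τ₂) :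
    PairwiseBoolean τ₂ τ₁ where
  hausdorff x y hxy := by
    obtain ⟨U, V, hU, hV, hy, hx, hd⟩ := h.hausdorff y x hxy.symm
    exact ⟨V, U, hV, hU, hx, hy, hd.symm⟩
  zeroDim₁ := h.zeroDim₂
  zeroDim₂ := h.zeroDim₁
  compact := inf_comm τ₁ τ₂ ▸ h.compact

/-- The two topologies of a pairwise Boolean space coincide. -/
theorem PairwiseBoolean.eq {τ₁ τ₂ : TopologicalSpace X} (h : PairwiseBoolean τ₁ τ₂) :
    τ₁ = τ₂ := by
  have key : ∀ {σ₁ σ₂ : TopologicalSpace X}, PairwiseBoolean σ₁ σ₂ → σ₁ ≤ σ₂ := by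
    intro σ₁ σ₂ h
    rw [h.zeroDim₂.eq_generateFrom]
    exact le_generateFrom (fun U hU => h.isOpen_of_mem hU)
  exact le_antisymm (key h) (key h.symm)

/-- In a pairwise Boolean space, closedness for both topologies is the same as closedness for the
join of the two topologies. -/
theorem PairwiseBoolean.pairwiseClosed_iff {τ₁ τ₂ : TopologicalSpace X}
    (h : PairwiseBoolean τ₁ τ₂) {C : Set X} : PairwiseClosed τ₁ τ₂ C ↔ IsClosed[τ₁ ⊓ τ₂] C := by
  obtain rfl := h.eq
  rw [inf_idem]
  exact and_self_iff

theorem PairwiseBoolean.t2Space {τ : TopologicalSpace X} (h : PairwiseBoolean τ τ) :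
    T2Space X :=
  ⟨fun x y hxy => h.hausdorff x y hxy⟩

theorem PairwiseBoolean.compactSpace {τ : TopologicalSpace X} (h : PairwiseBoolean τ τ) :
    CompactSpace X := by
  have := h.compact
  rwa [inf_idem] at this

theorem PairwiseBoolean.mem_bβ {τ : TopologicalSpace X} {U : Set X} :
    U ∈ bβ τ τ ↔ IsClopen U := by
  simp [bβ, IsClopen, and_comm]

end Bitopology

/-! ### Pairwise Vietoris spaces -/

section Vietoris

variable {X : Type u}

/-- The set `𝒦(X)` of pairwise closed subsets. -/
def PClosed (τ₁ τ₂ : TopologicalSpace X) : Type u := {C : Set X // PairwiseClosed τ₁ τ₂ C}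

/-- `□U = {C ∈ 𝒦(X) : C ⊆ U}`. -/
def boxSet (τ₁ τ₂ : TopologicalSpace X) (U : Set X) : Set (PClosed τ₁ τ₂) := {C | C.1 ⊆ U}

/-- `◇U = {C ∈ 𝒦(X) : C ∩ U ≠ ∅}`. -/
def diaSet (τ₁ τ₂ : TopologicalSpace X) (U : Set X) : Set (PClosed τ₁ τ₂) :=
  {C | (C.1 ∩ U).Nonempty}

/-- The topology `τ₁ⱽ` on `𝒦(X)`, generated by `□U` and `◇U` for `U ∈ β₁`. -/
@[reducible]
def vietoris₁ (τ₁ τ₂ : TopologicalSpace X) : TopologicalSpace (PClosed τ₁ τ₂) :=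
  TopologicalSpace.generateFrom
    (boxSet τ₁ τ₂ '' bβ τ₁ τ₂ ∪ diaSet τ₁ τ₂ '' bβ τ₁ τ₂)

/-- The topology `τ₂ⱽ` on `𝒦(X)`, generated by `□U` and `◇U` for `U ∈ β₂`. -/
@[reducible]
def vietoris₂ (τ₁ τ₂ : TopologicalSpace X) : TopologicalSpace (PClosed τ₁ τ₂) :=
  TopologicalSpace.generateFrom
    (boxSet τ₁ τ₂ '' bβ τ₂ τ₁ ∪ diaSet τ₁ τ₂ '' bβ τ₂ τ₁)

theorem compl_boxSet (τ₁ τ₂ : TopologicalSpace X) (U : Set X) :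
    (boxSet τ₁ τ₂ U)ᶜ = diaSet τ₁ τ₂ Uᶜ := by
  ext C
  simp only [boxSet, diaSet, Set.mem_compl_iff, Set.mem_ofPred_eq]
  rw [Set.inter_compl_nonempty_iff]

theorem compl_diaSet (τ₁ τ₂ : TopologicalSpace X) (U : Set X) :
    (diaSet τ₁ τ₂ U)ᶜ = boxSet τ₁ τ₂ Uᶜ := by
  rw [← compl_compl (boxSet τ₁ τ₂ Uᶜ), compl_boxSet, compl_compl]

theorem isClopen_boxSet (τ : TopologicalSpace X) {U : Set X} (hU : IsClopen U) :
    @IsClopen _ (vietoris₁ τ τ) (boxSet τ τ U) := by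
  let := vietoris₁ τ τ
  refine ⟨⟨?_⟩, ?_⟩
  · rw [compl_boxSet]
    exact TopologicalSpace.isOpen_generateFrom_of_mem
      (Or.inr ⟨_, PairwiseBoolean.mem_bβ.2 hU.compl, rfl⟩)
  · exact TopologicalSpace.isOpen_generateFrom_of_mem
      (Or.inl ⟨_, PairwiseBoolean.mem_bβ.2 hU, rfl⟩)

theorem isClopen_diaSet (τ : TopologicalSpace X) {U : Set X} (hU : IsClopen U) :
    @IsClopen _ (vietoris₁ τ τ) (diaSet τ τ U) := by
  let := vietoris₁ τ τ
  have := (isClopen_boxSet τ hU.compl).compl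
  rwa [compl_boxSet, compl_compl] at this

/-- The pairwise Vietoris space of a pairwise Boolean space is pairwise Boolean. -/
theorem PairwiseBoolean.vietoris {τ₁ τ₂ : TopologicalSpace X} (h : PairwiseBoolean τ₁ τ₂) :
    PairwiseBoolean (vietoris₁ τ₁ τ₂) (vietoris₂ τ₁ τ₂) := by
  obtain rfl := h.eq
  have hv : vietoris₂ τ₁ τ₁ = vietoris₁ τ₁ τ₁ := rfl
  rw [hv]
  let tv := vietoris₁ τ₁ τ₁
  have := h.compactSpace
  have hz : TopologicalSpace.IsTopologicalBasis (bβ (vietoris₁ τ₁ τ₁) (vietoris₁ τ₁ τ₁)) := by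
    refine TopologicalSpace.isTopologicalBasis_of_isOpen_of_nhds (fun U hU => hU.1) ?_
    intro C O hC hO
    obtain ⟨B, ⟨f, ⟨hf, hfs⟩, rfl⟩, hCB, hBO⟩ :=
      (TopologicalSpace.isTopologicalBasis_of_subbasis
        (rfl : tv = TopologicalSpace.generateFrom _)).exists_subset_of_mem_open hC hO
    refine ⟨_, PairwiseBoolean.mem_bβ.2 ?_, hCB, hBO⟩
    change IsClopen (⋂₀ f)
    rw [Set.sInter_eq_biInter]
    refine hf.isClopen_biInter (fun s hs => ?_)
    rcases hfs hs with ⟨U, hU, rfl⟩ | ⟨U, hU, rfl⟩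
    · exact isClopen_boxSet τ₁ (PairwiseBoolean.mem_bβ.1 hU)
    · exact isClopen_diaSet τ₁ (PairwiseBoolean.mem_bβ.1 hU)
  have hsep : ∀ C D : PClosed τ₁ τ₁, ¬ C.1 ⊆ D.1 →
      ∃ W, IsClopen W ∧ C ∈ W ∧ D ∉ W := by
    intro C D hCD
    obtain ⟨z, hzC, hzD⟩ := Set.not_subset.1 hCD
    obtain ⟨U, hU, hzU, hUD⟩ := h.zeroDim₁.exists_subset_of_mem_open
      (show z ∈ D.1ᶜ from hzD) D.2.1.isOpen_compl
    refine ⟨_, isClopen_diaSet τ₁ (PairwiseBoolean.mem_bβ.1 hU), ⟨z, hzC, hzU⟩, ?_⟩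
    rintro ⟨w, hwD, hwU⟩
    exact hUD hwU hwD
  refine ⟨?_, hz, hz, ?_⟩
  · intro C D hne
    by_cases hCD : C.1 ⊆ D.1
    · have hDC : ¬ D.1 ⊆ C.1 := fun hDC => hne (Subtype.ext (hCD.antisymm hDC))
      obtain ⟨W, hW, hDW, hCW⟩ := hsep D C hDC
      exact ⟨Wᶜ, W, hW.compl.2, hW.2, hCW, hDW, disjoint_compl_left⟩
    · obtain ⟨W, hW, hCW, hDW⟩ := hsep C D hCD
      exact ⟨W, Wᶜ, hW.2, hW.compl.2, hCW, hDW, disjoint_compl_right⟩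
  · rw [inf_idem]
    refine compactSpace_generateFrom (rfl : tv = TopologicalSpace.generateFrom _) ?_
    intro P hP hcov
    let 𝒟 : Set (Set X) := {V | IsClopen V ∧ diaSet τ₁ τ₁ V ∈ P}
    have hDcl : IsClosed (⋃₀ 𝒟)ᶜ :=
      (isOpen_sUnion (fun V hV => hV.1.2)).isClosed_compl
    let S₁ : PClosed τ₁ τ₁ := ⟨(⋃₀ 𝒟)ᶜ, hDcl, hDcl⟩
    obtain ⟨Q, hQ, hSQ⟩ : S₁ ∈ ⋃₀ P := by rw [hcov]; trivial
    rcases hP hQ with ⟨U, hU, rfl⟩ | ⟨U, hU, rfl⟩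
    · have hU' := PairwiseBoolean.mem_bβ.1 hU
      have hUc : Uᶜ ⊆ ⋃ V : 𝒟, V.1 := by
        rw [← Set.sUnion_eq_iUnion]
        exact Set.compl_subset_comm.1 hSQ
      obtain ⟨t, ht⟩ := hU'.compl.1.isCompact.elim_finite_subcover (fun V : 𝒟 => V.1)
        (fun V => V.2.1.2) hUc
      refine ⟨insert (boxSet τ₁ τ₁ U) ((fun V : 𝒟 => diaSet τ₁ τ₁ V.1) '' (t : Set 𝒟)), ?_, ?_, ?_⟩
      · rintro _ (rfl | ⟨V, _, rfl⟩)
        · exact hQ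
        · exact V.2.2
      · exact (t.finite_toSet.image _).insert _
      · refine Set.eq_univ_of_forall (fun C => ?_)
        by_cases hC : C.1 ⊆ U
        · exact ⟨_, Set.mem_insert _ _, hC⟩
        · obtain ⟨z, hzC, hzU⟩ := Set.not_subset.1 hC
          obtain ⟨V, hV, hzV⟩ := Set.mem_iUnion₂.1 (ht hzU)
          exact ⟨_, Set.mem_insert_of_mem _ ⟨V, hV, rfl⟩, ⟨z, hzC, hzV⟩⟩
    · obtain ⟨z, hz₁, hz₂⟩ := hSQ
      exact absurd ⟨U, ⟨PairwiseBoolean.mem_bβ.1 hU, hQ⟩, hz₂⟩ hz₁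

/-- For a pairwise closed `D`, the set of pairwise closed subsets contained in `D` is pairwise
closed in the pairwise Vietoris space. -/
theorem PairwiseBoolean.pairwiseClosed_boxSet {τ₁ τ₂ : TopologicalSpace X}
    (h : PairwiseBoolean τ₁ τ₂) {D : Set X} (hD : PairwiseClosed τ₁ τ₂ D) :
    PairwiseClosed (vietoris₁ τ₁ τ₂) (vietoris₂ τ₁ τ₂) (boxSet τ₁ τ₂ D) := by
  obtain rfl := h.eq
  have hcl : IsClosed[vietoris₁ τ₁ τ₁] (boxSet τ₁ τ₁ D) := by
    let := vietoris₁ τ₁ τ₁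
    rw [← isOpen_compl_iff, isOpen_iff_forall_mem_open]
    intro C hC
    obtain ⟨z, hzC, hzD⟩ := Set.not_subset.1 (show ¬ C.1 ⊆ D from hC)
    obtain ⟨U, hU, hzU, hUD⟩ := h.zeroDim₁.exists_subset_of_mem_open
      (show z ∈ Dᶜ from hzD) hD.1.isOpen_compl
    refine ⟨diaSet τ₁ τ₁ U, ?_, (isClopen_diaSet τ₁ (PairwiseBoolean.mem_bβ.1 hU)).2,
      ⟨z, hzC, hzU⟩⟩
    rintro E ⟨w, hwE, hwU⟩ hE
    exact hUD hwU (hE hwE)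
  exact ⟨hcl, hcl⟩

end Vietoris

/-! ### The category of `L`-valued pairwise Boolean spaces -/

/-- Objects of `PBS_L`: a pairwise Boolean space with a pairwise closed subspace `α M` for each
subalgebra `M` of `L`, such that `α L` is the whole space and `α` preserves binary meets. -/
structure PBSL (L : Type u) [HeytingAlgebra L] where
  carrier : Type u
  τ₁ : TopologicalSpace carrier
  τ₂ : TopologicalSpace carrier
  pairwiseBoolean : PairwiseBoolean τ₁ τ₂
  α : SubAlg L → Set carrier
  α_closed : ∀ M : SubAlg L, PairwiseClosed τ₁ τ₂ (α M)
  α_top : α ⊤ = Set.univ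
  α_inf : ∀ M N : SubAlg L, α (M ⊓ N) = α M ∩ α N

/-- Arrows of `PBS_L`: pairwise continuous subspace preserving maps. -/
@[ext]
structure PBSLHom {L : Type u} [HeytingAlgebra L] (X Y : PBSL L) where
  toFun : X.carrier → Y.carrier
  continuous₁ : Continuous[X.τ₁, Y.τ₁] toFun
  continuous₂ : Continuous[X.τ₂, Y.τ₂] toFun
  map_α : ∀ (M : SubAlg L), ∀ x ∈ X.α M, toFun x ∈ Y.α M

/-- The category `PBS_L`. -/
instance (L : Type u) [HeytingAlgebra L] : Category (PBSL L) where
  Hom X Y := PBSLHom X Y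
  id X := ⟨id, @continuous_id _ X.τ₁, @continuous_id _ X.τ₂, fun _ _ h => h⟩
  comp {X Y Z} f g := ⟨g.toFun ∘ f.toFun,
    @Continuous.comp _ _ _ X.τ₁ Y.τ₁ Z.τ₁ _ _ g.continuous₁ f.continuous₁,
    @Continuous.comp _ _ _ X.τ₂ Y.τ₂ Z.τ₂ _ _ g.continuous₂ f.continuous₂,
    fun M x hx => g.map_α M _ (f.map_α M x hx)⟩

section Functor

variable {L : Type u} [HeytingAlgebra L]

/-- An arrow of `PBS_L` maps pairwise closed sets to pairwise closed sets. -/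
theorem PBSLHom.pairwiseClosed_image {X Y : PBSL L} (f : PBSLHom X Y) {C : Set X.carrier}
    (hC : PairwiseClosed X.τ₁ X.τ₂ C) : PairwiseClosed Y.τ₁ Y.τ₂ (f.toFun '' C) := by
  obtain ⟨X, s₁, s₂, hX, _, _, _, _⟩ := X
  obtain ⟨Y, t₁, t₂, hY, _, _, _, _⟩ := Y
  obtain ⟨f, hf, _, _⟩ := f
  obtain rfl : s₁ = s₂ := hX.eq
  obtain rfl : t₁ = t₂ := hY.eq
  have := hX.compactSpace
  have := hY.t2Space
  have : IsClosed (f '' C) := (hC.1.isCompact.image hf).isClosed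
  exact ⟨this, this⟩

/-- The object part of the `L`-biVietoris functor: the pairwise Vietoris space `V_P(X)`, with
`V_P(α M)`, regarded as a subset of `V_P(X)`, attached to the subalgebra `M`. (The pairwise closed
subsets of the pairwise closed subspace `α M` are the pairwise closed subsets of `X` contained
in `α M`.) -/
def biVietorisObj (X : PBSL L) : PBSL L where
  carrier := PClosed X.τ₁ X.τ₂
  τ₁ := vietoris₁ X.τ₁ X.τ₂
  τ₂ := vietoris₂ X.τ₁ X.τ₂
  pairwiseBoolean := X.pairwiseBoolean.vietoris
  α M := {C | C.1 ⊆ X.α M}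
  α_closed M := X.pairwiseBoolean.pairwiseClosed_boxSet (X.α_closed M)
  α_top := Set.eq_univ_of_forall (fun C => by simp [X.α_top])
  α_inf M N := by
    ext C
    simp [X.α_inf]

/-- The arrow part of the `L`-biVietoris functor: `K ↦ f[K]`. -/
def biVietorisMap {X Y : PBSL L} (f : PBSLHom X Y) :
    PBSLHom (biVietorisObj X) (biVietorisObj Y) where
  toFun K := ⟨f.toFun '' K.1, f.pairwiseClosed_image K.2⟩
  continuous₁ := by
    refine continuous_generateFrom_iff.2 ?_
    rintro _ (⟨U, hU, rfl⟩ | ⟨U, hU, rfl⟩)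
    · refine TopologicalSpace.isOpen_generateFrom_of_mem (Or.inl ⟨f.toFun ⁻¹' U,
        preimage_mem_bβ f.continuous₁ f.continuous₂ hU, ?_⟩)
      ext K
      exact Set.image_subset_iff.symm
    · refine TopologicalSpace.isOpen_generateFrom_of_mem (Or.inr ⟨f.toFun ⁻¹' U,
        preimage_mem_bβ f.continuous₁ f.continuous₂ hU, ?_⟩)
      ext K
      exact Set.image_inter_nonempty_iff.symm
  continuous₂ := by
    refine continuous_generateFrom_iff.2 ?_
    rintro _ (⟨U, hU, rfl⟩ | ⟨U, hU, rfl⟩)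
    · refine TopologicalSpace.isOpen_generateFrom_of_mem (Or.inl ⟨f.toFun ⁻¹' U,
        preimage_mem_bβ f.continuous₂ f.continuous₁ hU, ?_⟩)
      ext K
      exact Set.image_subset_iff.symm
    · refine TopologicalSpace.isOpen_generateFrom_of_mem (Or.inr ⟨f.toFun ⁻¹' U,
        preimage_mem_bβ f.continuous₂ f.continuous₁ hU, ?_⟩)
      ext K
      exact Set.image_inter_nonempty_iff.symm
  map_α M K hK := by
    rintro _ ⟨x, hx, rfl⟩
    exact f.map_α M x (hK hx)

end Functor

/-- The `L`-biVietoris endofunctor `V_L^bi` on `PBS_L`. -/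
def biVietoris (L : Type u) [HeytingAlgebra L] : PBSL L ⥤ PBSL L where
  obj X := biVietorisObj X
  map f := biVietorisMap f
  map_id _ := PBSLHom.ext (funext fun K => Subtype.ext (Set.image_id K.1))
  map_comp f g := PBSLHom.ext (funext fun K => Subtype.ext (Set.image_comp g.toFun f.toFun K.1))

end FittingDuality

/-!
The duality extends the natural duality between `L`-`VL`-algebras and `L`-valued Boolean spaces in
the style of Jónsson and Tarski. An algebra `A` is sent to the set of its points, the homomorphisms
`v : A → L` for the operations other than `□`, as a subspace of the power of the discrete space `L`.
The subalgebra `M` is assigned the points with values in `M`, and the point `v` has as successors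
the points `w` with `v (□ a) ≤ w a` for all `a`. This functor is shown to be fully faithful and
essentially surjective.

On the algebraic side, every prime ideal of `A` yields a point, whose value at `a` is the only `l`
such that `T_l(a)` avoids the ideal (`pointOfPrime`). With the prime ideal theorem it follows that
the points separate elements (`MLAlg.ext_point`) and that `v (□ a)` is the infimum of the values of
the successors of `v` at `a` (`Point.le_map_box_iff`). Moreover a successor of `v` takes values
among those of `v` (`Point.range_subset_of_mem_successors`), which makes the successor map an arrow
of `PBS_L`.

On the topological side, compactness of the space of points shows that the evaluations at elements
of `A` are exactly the admissible functions: the locally constant functions to `L` that send the set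
assigned to `M` into `M` (`Point.exists_eval_eq`). A morphism of canonical coalgebras carries
admissible functions to admissible functions, hence comes from a homomorphism; this is fullness.

For essential surjectivity, the admissible functions on a coalgebra form an algebra, with `□ f` the
infimum of `f` over the successors (`dualAlgebra`). Evaluation is a homeomorphism onto its space of
points and an isomorphism of coalgebras (`evalIso`). The assigned sets are recovered because only
finitely many subalgebras exist and meets are preserved, so that admissible functions can be
prescribed near a point with any value in the least subalgebra attached to that point
(`range_evalPoint_subset_iff`). The two topologies of a pairwise Boolean space are equal, and
everything is done with the first one.
-/

namespace FittingDuality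

/-! ### The truth value algebra -/

section TruthValues

variable {L : Type u} [HeytingAlgebra L]

theorem truthT_self (l : L) : truthT l l = ⊤ := if_pos rfl

theorem truthT_of_ne {l x : L} (h : x ≠ l) : truthT l x = ⊥ := if_neg h

theorem truthT_eq_top_iff [Nontrivial L] {l x : L} : truthT l x = ⊤ ↔ x = l := by
  by_cases h : x = l <;> simp [truthT, h]

variable [Fintype L]

theorem opU_truthT_of_le {l x : L} (h : l ≤ x) : opU truthT l x = ⊤ := by
  classical
  refine top_unique ?_
  rw [← truthT_self x, opU]
  exact Finset.le_sup (f := fun l' => truthT l' x) (by simpa using h)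

theorem opU_truthT_of_not_le {l x : L} (h : ¬ l ≤ x) : opU truthT l x = ⊥ := by
  classical
  refine (Finset.sup_eq_bot_iff _ _).2 fun l' hl' => truthT_of_ne ?_
  rintro rfl
  exact h (by simpa using hl')

theorem opU_truthT_eq_top_iff [Nontrivial L] {l x : L} : opU truthT l x = ⊤ ↔ l ≤ x := by
  by_cases h : l ≤ x
  · simp [h, opU_truthT_of_le]
  · simp [h, opU_truthT_of_not_le]

end TruthValues

/-! ### Points of an algebra -/

section Points

variable {L : Type u} [HeytingAlgebra L] [Fintype L] {A : MLAlg L}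

theorem MLAlg.box_mono {a b : A.carrier} (h : a ≤ b) : A.box a ≤ A.box b := by
  rw [← inf_eq_left.2 h, A.box_inf]
  exact inf_le_right

theorem MLAlg.opU_bot (a : A.carrier) : opU A.T ⊥ a = ⊤ := by
  simp [opU, A.isVLAlgebra.T_cover]

theorem MLAlg.box_top : A.box ⊤ = ⊤ := by
  conv_lhs => rw [← A.opU_bot ⊤, A.box_U, A.opU_bot]

/-- A point of an algebra `A`: a homomorphism of `L`-`VL`-algebras from `A` to `L`. It need not
preserve `□`, for which `L` carries no operation. -/
def Point (A : MLAlg L) : Type u :=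
  {v : HeytingHom A.carrier L // ∀ l a, v (A.T l a) = truthT l (v a)}

namespace Point

instance : FunLike (Point A) A.carrier L where
  coe v a := v.1 a
  coe_injective _ _ h := Subtype.ext (DFunLike.coe_injective h)

instance : HeytingHomClass (Point A) A.carrier L where
  map_sup v := map_sup v.1
  map_inf v := map_inf v.1
  map_bot v := map_bot v.1
  map_himp v := map_himp v.1

theorem map_T (v : Point A) (l : L) (a : A.carrier) : v (A.T l a) = truthT l (v a) := v.2 l a

theorem map_opU (v : Point A) (l : L) (a : A.carrier) :
    v (opU A.T l a) = opU truthT l (v a) := by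
  simp only [opU, map_finset_sup, Function.comp_def, map_T]

/-- The subalgebra of `L` of the values of a point. -/
def range (v : Point A) : SubAlg L where
  carrier := Set.range v
  bot_mem := ⟨⊥, map_bot v⟩
  top_mem := ⟨⊤, map_top v⟩
  inf_mem := by
    rintro _ _ ⟨a, rfl⟩ ⟨b, rfl⟩
    exact ⟨a ⊓ b, map_inf v a b⟩
  sup_mem := by
    rintro _ _ ⟨a, rfl⟩ ⟨b, rfl⟩
    exact ⟨a ⊔ b, map_sup v a b⟩
  himp_mem := by
    rintro _ _ ⟨a, rfl⟩ ⟨b, rfl⟩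
    exact ⟨a ⇨ b, map_himp v a b⟩
  T_mem := by
    rintro l _ ⟨a, rfl⟩
    exact ⟨A.T l a, v.map_T l a⟩

end Point

theorem existsUnique_T_notMem {J : Order.Ideal A.carrier} (hJ : J.IsPrime) (a : A.carrier) :
    ∃! l : L, A.T l a ∉ J := by
  have hex : ∃ l : L, A.T l a ∉ J := by
    by_contra! h
    refine hJ.top_notMem ?_
    rw [← A.isVLAlgebra.T_cover a]
    exact (Order.Ideal.finsetSup_mem_iff J).2 fun l _ => h l
  obtain ⟨l, hl⟩ := hex
  refine ⟨l, hl, fun l' hl' => ?_⟩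
  by_contra hne
  rcases hJ.mem_or_mem (x := A.T l' a) (y := A.T l a)
    (by rw [A.isVLAlgebra.T_disjoint _ _ _ hne]; exact J.bot_mem) with h | h
  · exact hl' h
  · exact hl h

/-- The value at `a` of the point given by a prime ideal `J`: the only `l` such that `T l a` lies in
the prime filter complementary to `J`. -/
noncomputable def primeValue {J : Order.Ideal A.carrier} (hJ : J.IsPrime) (a : A.carrier) : L :=
  (existsUnique_T_notMem hJ a).choose

theorem primeValue_eq_iff {J : Order.Ideal A.carrier} (hJ : J.IsPrime) {a : A.carrier} {l : L} :
    primeValue hJ a = l ↔ A.T l a ∉ J := by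
  have h := (existsUnique_T_notMem hJ a).choose_spec
  exact ⟨fun e => e ▸ h.1, fun hl => (h.2 l hl).symm⟩

theorem T_primeValue_notMem {J : Order.Ideal A.carrier} (hJ : J.IsPrime) (a : A.carrier) :
    A.T (primeValue hJ a) a ∉ J := (primeValue_eq_iff hJ).1 rfl

theorem T_inf_T_notMem {J : Order.Ideal A.carrier} (hJ : J.IsPrime) (a b : A.carrier) :
    A.T (primeValue hJ a) a ⊓ A.T (primeValue hJ b) b ∉ J := fun h =>
  (hJ.mem_or_mem h).elim (T_primeValue_notMem hJ a) (T_primeValue_notMem hJ b)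

/-- The point given by a prime ideal. -/
noncomputable def pointOfPrime {J : Order.Ideal A.carrier} (hJ : J.IsPrime) : Point A :=
  ⟨{ toFun := primeValue hJ
     map_sup' a b := (primeValue_eq_iff hJ).2 fun h =>
       T_inf_T_notMem hJ a b (J.lower (A.isVLAlgebra.T_sup _ _ _ _) h)
     map_inf' a b := (primeValue_eq_iff hJ).2 fun h =>
       T_inf_T_notMem hJ a b (J.lower (A.isVLAlgebra.T_inf _ _ _ _) h)
     map_bot' := (primeValue_eq_iff hJ).2 (by
       rw [A.isVLAlgebra.T_bot_bot]; exact hJ.top_notMem)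
     map_himp' a b := (primeValue_eq_iff hJ).2 fun h =>
       T_inf_T_notMem hJ a b (J.lower (A.isVLAlgebra.T_himp _ _ _ _) h) },
   fun _ a => (primeValue_eq_iff hJ).2 fun h =>
     T_primeValue_notMem hJ a (J.lower (A.isVLAlgebra.T_T _ _ _) h)⟩

theorem pointOfPrime_eq_iff {J : Order.Ideal A.carrier} (hJ : J.IsPrime) {a : A.carrier} {l : L} :
    pointOfPrime hJ a = l ↔ A.T l a ∉ J := primeValue_eq_iff hJ

theorem MLAlg.T_le_T_of_forall_point {a b : A.carrier} (h : ∀ v : Point A, v a = v b) (l : L) :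
    A.T l a ≤ A.T l b := by
  by_contra hle
  obtain ⟨J, hJ, hI, hF⟩ := DistribLattice.prime_ideal_of_disjoint_filter_ideal
    (F := Order.PFilter.principal (A.T l a)) (I := Order.Ideal.principal (A.T l b))
    (Set.disjoint_left.2 fun c h₁ h₂ => hle (le_trans h₁ h₂))
  have ha : pointOfPrime hJ a = l :=
    (pointOfPrime_eq_iff hJ).2 (Set.disjoint_left.1 hF (Order.PFilter.mem_principal.2 le_rfl))
  exact (pointOfPrime_eq_iff hJ).1 ((h _).symm.trans ha) (Order.Ideal.principal_le_iff.1 hI)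

/-- Points separate the elements of an algebra. The prime ideal theorem shows that `T l a = T l b`
for all `l`, and the last axiom of `L`-`VL`-algebras turns this into `a = b`. -/
theorem MLAlg.ext_point {a b : A.carrier} (h : ∀ v : Point A, v a = v b) : a = b := by
  have hT : ∀ l : L, A.T l a = A.T l b := fun l =>
    le_antisymm (A.T_le_T_of_forall_point h l) (A.T_le_T_of_forall_point (fun v => (h v).symm) l)
  have := A.isVLAlgebra.T_ext a b
  simp only [hT, bihimp_self, Finset.inf_top, top_le_iff] at this
  exact bihimp_eq_top.1 this

/-- The canonical accessibility relation: `w` is accessible from `v` if `v (□ a) ≤ w a` for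
all `a`. -/
def Point.successors (v : Point A) : Set (Point A) := {w | ∀ a, v (A.box a) ≤ w a}

/-- The Jónsson–Tarski lemma: `v (□ a)` is the infimum of the values `w a`, for `w` accessible
from `v`. -/
theorem Point.le_map_box_iff [Nontrivial L] (v : Point A) {l : L} {a : A.carrier} :
    l ≤ v (A.box a) ↔ ∀ w ∈ v.successors, l ≤ w a := by
  refine ⟨fun h w hw => h.trans (hw a), fun h => ?_⟩
  by_contra hl
  have hF : Order.IsPFilter {c | v (A.box c) = ⊤} := by
    refine Order.IsPFilter.of_def ⟨⊤, ?_⟩ ?_ ?_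
    · exact (congrArg v A.box_top).trans (map_top v)
    · intro b hb c hc
      refine ⟨b ⊓ c, ?_, inf_le_left, inf_le_right⟩
      change v (A.box (b ⊓ c)) = ⊤
      rw [A.box_inf, map_inf, show v (A.box b) = ⊤ from hb, show v (A.box c) = ⊤ from hc,
        top_inf_eq]
    · intro b c hbc hb
      exact top_unique ((show v (A.box b) = ⊤ from hb).ge.trans
        (OrderHomClass.mono v (A.box_mono hbc)))
  obtain ⟨J, hJ, hI, hJF⟩ := DistribLattice.prime_ideal_of_disjoint_filter_ideal
    (F := hF.toPFilter) (I := Order.Ideal.principal (opU A.T l a)) (by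
      refine Set.disjoint_left.2 fun c h₁ h₂ => hl ?_
      have h₃ : v (A.box (opU A.T l a)) = ⊤ := top_unique
        ((show v (A.box c) = ⊤ from h₁).ge.trans (OrderHomClass.mono v (A.box_mono h₂)))
      rwa [A.box_U, v.map_opU, opU_truthT_eq_top_iff] at h₃)
  have hU : ∀ {m : L} {c : A.carrier}, opU A.T m c ∉ J → m ≤ pointOfPrime hJ c := by
    classical
    intro m c hm
    by_contra hc
    refine hm ((Order.Ideal.finsetSup_mem_iff J).2 fun l' hl' => ?_)
    by_contra hJ'
    rw [(pointOfPrime_eq_iff hJ).2 hJ'] at hc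
    exact hc (by simpa using hl')
  refine T_primeValue_notMem hJ a (J.lower ?_ (Order.Ideal.principal_le_iff.1 hI))
  classical
  refine Finset.le_sup (f := fun l' => A.T l' a) ?_
  simp only [Finset.mem_filter, Finset.mem_univ, true_and]
  refine h (pointOfPrime hJ) fun c => hU (Set.disjoint_left.1 hJF ?_)
  change v (A.box (opU A.T _ c)) = ⊤
  rw [A.box_U, v.map_opU, opU_truthT_of_le le_rfl]

/-- Accessible points have no new values. If `w a = l`, then `b = T_l(a) ⇨ a` has `w b = l` and
`l ≤ b` everywhere, so that `v (□ b) = l`. -/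
theorem Point.range_subset_of_mem_successors [Nontrivial L] {v w : Point A}
    (hw : w ∈ v.successors) : Set.range w ⊆ Set.range v := by
  rintro _ ⟨a, rfl⟩
  refine ⟨A.box (A.T (w a) a ⇨ a), le_antisymm ?_ (v.le_map_box_iff.2 fun u _ => ?_)⟩
  · refine (hw _).trans ?_
    rw [map_himp, map_T, truthT_self, top_himp]
  · rw [map_himp, map_T]
    by_cases h : u a = w a
    · rw [h]
      exact le_himp
    · simp [truthT_of_ne h]

end Points

/-! ### The space of points -/

section PointSpace

variable {L : Type u} [HeytingAlgebra L] [Fintype L] {A : MLAlg L}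

/-- The topology of pointwise convergence, for the discrete topology on `L`. -/
instance : TopologicalSpace (Point A) :=
  TopologicalSpace.induced (fun v a => v a) (@Pi.topologicalSpace A.carrier (fun _ => L) fun _ => ⊥)

theorem Point.isLocallyConstant_eval (a : A.carrier) :
    IsLocallyConstant (fun v : Point A => v a) := by
  let : TopologicalSpace L := ⊥
  have : DiscreteTopology L := ⟨rfl⟩
  exact (IsLocallyConstant.iff_continuous _).2 ((continuous_apply a).comp continuous_induced_dom)

theorem Point.isClosed_range : IsClosed[@Pi.topologicalSpace A.carrier (fun _ => L) fun _ => ⊥]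
    (Set.range fun (v : Point A) a => v a) := by
  let : TopologicalSpace L := ⊥
  have : DiscreteTopology L := ⟨rfl⟩
  have happ : ∀ a : A.carrier, Continuous fun f : A.carrier → L => f a := continuous_apply
  have hcomp : ∀ (g : L → L → L) (a b : A.carrier),
      Continuous fun f : A.carrier → L => g (f a) (f b) := fun g a b =>
    (continuous_of_discreteTopology (f := Function.uncurry g)).comp ((happ a).prodMk (happ b))
  have : (Set.range fun (v : Point A) a => v a) =
      (⋂ (a) (b), {f | f (a ⊔ b) = f a ⊔ f b}) ∩ (⋂ (a) (b), {f | f (a ⊓ b) = f a ⊓ f b}) ∩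
      {f | f ⊥ = ⊥} ∩ (⋂ (a) (b), {f | f (a ⇨ b) = f a ⇨ f b}) ∩
      ⋂ (l) (a), {f | f (A.T l a) = truthT l (f a)} := by
    ext f
    simp only [Set.mem_range, Set.mem_inter_iff, Set.mem_iInter, Set.mem_ofPred_eq]
    refine ⟨?_, fun ⟨⟨⟨⟨h₁, h₂⟩, h₃⟩, h₄⟩, h₅⟩ => ⟨⟨⟨⟨⟨f, h₁⟩, h₂⟩, h₃, h₄⟩, h₅⟩, rfl⟩⟩
    rintro ⟨v, rfl⟩
    exact ⟨⟨⟨⟨map_sup v, map_inf v⟩, map_bot v⟩, map_himp v⟩, v.map_T⟩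
  rw [this]
  refine (((IsClosed.inter ?_ ?_).inter ?_).inter ?_).inter ?_
  · exact isClosed_iInter fun a => isClosed_iInter fun b => isClosed_eq (happ _) (hcomp (· ⊔ ·) a b)
  · exact isClosed_iInter fun a => isClosed_iInter fun b => isClosed_eq (happ _) (hcomp (· ⊓ ·) a b)
  · exact isClosed_eq (happ _) continuous_const
  · exact isClosed_iInter fun a => isClosed_iInter fun b => isClosed_eq (happ _) (hcomp (· ⇨ ·) a b)
  · exact isClosed_iInter fun l => isClosed_iInter fun a =>
      isClosed_eq (happ _) (hcomp (fun x _ => truthT l x) a a)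

instance : CompactSpace (Point A) := by
  let : TopologicalSpace L := ⊥
  have : DiscreteTopology L := ⟨rfl⟩
  exact Topology.IsClosedEmbedding.compactSpace
    (f := fun (v : Point A) a => v a) ⟨⟨⟨rfl⟩, DFunLike.coe_injective⟩, Point.isClosed_range⟩

instance : T2Space (Point A) := by
  let : TopologicalSpace L := ⊥
  have : DiscreteTopology L := ⟨rfl⟩
  exact Topology.IsEmbedding.t2Space
    (f := fun (v : Point A) a => v a) ⟨⟨rfl⟩, DFunLike.coe_injective⟩

variable [Nontrivial L]

/-- The sets of the points taking the value `⊤` at a given two-valued element are a basis of the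
topology. -/
theorem Point.exists_basic_subset {U : Set (Point A)} (hU : IsOpen U) {v : Point A} (hv : v ∈ U) :
    ∃ c : A.carrier, v c = ⊤ ∧ (∀ w : Point A, w c = ⊤ ∨ w c = ⊥) ∧
      ∀ w : Point A, w c = ⊤ → w ∈ U := by
  let : TopologicalSpace L := ⊥
  obtain ⟨W, hW, rfl⟩ := isOpen_induced_iff.1 hU
  obtain ⟨I, u, hu, hIW⟩ := isOpen_pi_iff.1 hW _ hv
  have heval : ∀ w : Point A,
      w (I.inf fun a => A.T (v a) a) = I.inf fun a => truthT (v a) (w a) := fun w => by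
    simp only [map_finset_inf, Function.comp_def, map_T]
  refine ⟨I.inf fun a => A.T (v a) a, ?_, fun w => ?_, fun w hw => hIW fun a ha => ?_⟩
  · rw [heval, Finset.inf_eq_top_iff]
    exact fun a _ => truthT_self _
  · rw [heval]
    by_cases h : ∀ a ∈ I, w a = v a
    · exact Or.inl (Finset.inf_eq_top_iff _ _ |>.2 fun a ha => by rw [h a ha, truthT_self])
    · push Not at h
      obtain ⟨a, ha, hne⟩ := h
      exact Or.inr (bot_unique ((Finset.inf_le ha).trans (truthT_of_ne hne).le))
  · rw [heval, Finset.inf_eq_top_iff] at hw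
    change w a ∈ u a
    rw [truthT_eq_top_iff.1 (hw a ha)]
    exact (hu a ha).2

theorem Point.isTopologicalBasis_isClopen :
    TopologicalSpace.IsTopologicalBasis {U : Set (Point A) | IsClopen U} := by
  refine TopologicalSpace.isTopologicalBasis_of_isOpen_of_nhds (fun U hU => hU.2) ?_
  intro v U hv hU
  obtain ⟨c, hc, -, hcU⟩ := exists_basic_subset hU hv
  exact ⟨{w | w c = ⊤}, (isLocallyConstant_eval c).isClopen_fiber ⊤, hc, hcU⟩

/-- Clopen sets of points are represented by elements of the algebra. -/
theorem Point.exists_eq_indicator {U : Set (Point A)} (hU : IsClopen U) :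
    ∃ c : A.carrier, (∀ v ∈ U, v c = ⊤) ∧ ∀ v ∉ U, v c = ⊥ := by
  have : ∃ c : A.carrier, (∀ v ∈ U, v c = ⊤) ∧ ∀ v, v c ≠ ⊥ → v ∈ U := by
    refine hU.1.isCompact.induction_on
      (p := fun S => ∃ c : A.carrier, (∀ v ∈ S, v c = ⊤) ∧ ∀ v, v c ≠ ⊥ → v ∈ U) ?_ ?_ ?_ ?_
    · exact ⟨⊥, by simp, fun v hv => absurd (map_bot v) hv⟩
    · rintro S S' hS ⟨c, h₁, h₂⟩
      exact ⟨c, fun v hv => h₁ v (hS hv), h₂⟩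
    · rintro S S' ⟨c, h₁, h₂⟩ ⟨c', h₁', h₂'⟩
      refine ⟨c ⊔ c', ?_, fun v hv => ?_⟩
      · rintro v (hv | hv)
        · rw [map_sup, h₁ v hv, top_sup_eq]
        · rw [map_sup, h₁' v hv, sup_top_eq]
      · rw [map_sup, Ne, sup_eq_bot_iff, not_and_or] at hv
        exact hv.elim (h₂ v) (h₂' v)
    · intro v hv
      obtain ⟨c, hc, htwo, hcU⟩ := exists_basic_subset hU.2 hv
      refine ⟨{w | w c = ⊤}, mem_nhdsWithin_of_mem_nhds
        (((isLocallyConstant_eval c).isOpen_fiber ⊤).mem_nhds hc), c, fun w hw => hw, fun w hw => ?_⟩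
      exact hcU w ((htwo w).resolve_right hw)
  obtain ⟨c, h₁, h₂⟩ := this
  exact ⟨c, h₁, fun v hv => by_contra fun h => hv (h₂ v h)⟩

/-- Every locally constant function on the space of points whose value at each point is a value of
that point is the evaluation at an element of the algebra. Such a function is near every point an
evaluation, and two evaluations at `b` and `b'` are glued along the clopen set `c` where the first
one is right by `(c ⊓ b) ⊔ ((c ⇨ ⊥) ⊓ b')`. -/
theorem Point.exists_eval_eq {g : Point A → L} (hg : IsLocallyConstant g)
    (hr : ∀ v : Point A, g v ∈ Set.range v) : ∃ a : A.carrier, ∀ v : Point A, v a = g v := by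
  suffices ∃ a : A.carrier, ∀ v ∈ (Set.univ : Set (Point A)), v a = g v by simpa using this
  refine isCompact_univ.induction_on
    (p := fun S => ∃ a : A.carrier, ∀ v ∈ S, v a = g v) ?_ ?_ ?_ ?_
  · exact ⟨⊥, by simp⟩
  · rintro S S' hS ⟨a, ha⟩
    exact ⟨a, fun v hv => ha v (hS hv)⟩
  · rintro S S' ⟨b, hb⟩ ⟨b', hb'⟩
    obtain ⟨c, hc₁, hc₂⟩ := exists_eq_indicator (U := {v : Point A | v b = g v}) (by
      have hlc := ((isLocallyConstant_eval b).prodMk hg).comp (fun p : L × L => p.1 = p.2)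
      simpa using hlc.isClopen_fiber True)
    refine ⟨(c ⊓ b) ⊔ ((c ⇨ ⊥) ⊓ b'), fun v hv => ?_⟩
    by_cases h : v b = g v
    · simp [map_sup, map_inf, hc₁ v h, h]
    · simp [map_sup, map_inf, hc₂ v h, hb' v (hv.resolve_left fun hS => h (hb v hS))]
  · intro v _
    obtain ⟨a, ha⟩ := hr v
    have hlc := ((isLocallyConstant_eval a).prodMk hg).comp (fun p : L × L => p.1 = p.2)
    refine ⟨{w | w a = g w}, mem_nhdsWithin_of_mem_nhds (IsOpen.mem_nhds ?_ ha), a, fun w hw => hw⟩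
    simpa using hlc.isOpen_fiber True

end PointSpace

/-! ### The canonical coalgebra of an algebra -/

theorem PairwiseBoolean.of_isTopologicalBasis_isClopen {X : Type u} [t : TopologicalSpace X]
    [CompactSpace X] [T2Space X] (h : TopologicalSpace.IsTopologicalBasis {U : Set X | IsClopen U}) :
    PairwiseBoolean t t := by
  have hb : bβ t t = {U | IsClopen U} := Set.ext fun _ => PairwiseBoolean.mem_bβ
  exact ⟨fun _ _ => t2_separation, hb ▸ h, hb ▸ h, (inf_idem t).symm ▸ inferInstance⟩

section Spectrum

variable {L : Type u} [HeytingAlgebra L] [Fintype L] {A B : MLAlg L}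

theorem Point.continuous_of_eval {X : Type*} [TopologicalSpace X] {f : X → Point A}
    (hf : ∀ a, IsLocallyConstant fun x => f x a) : Continuous f := by
  let : TopologicalSpace L := ⊥
  have : DiscreteTopology L := ⟨rfl⟩
  exact continuous_induced_rng.2 (continuous_pi fun a => (hf a).continuous)

theorem Point.isClosed_setOf_eval_mem (a : A.carrier) (s : Set L) :
    IsClosed {v : Point A | v a ∈ s} :=
  ⟨isLocallyConstant_eval a sᶜ⟩

theorem Point.isClosed_successors (v : Point A) : IsClosed v.successors := by
  have : v.successors = ⋂ a, {w : Point A | w a ∈ Set.Ici (v (A.box a))} := by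
    ext w
    simp [successors]
  rw [this]
  exact isClosed_iInter fun a => isClosed_setOf_eval_mem a _

/-- Precomposition of points with a homomorphism. -/
def Point.comap (h : A ⟶ B) (v : Point B) : Point A :=
  ⟨v.1.comp h.toHeytingHom, fun l a =>
    (congrArg v (h.map_T l a)).trans (v.map_T l (h.toHeytingHom a))⟩

theorem Point.comap_apply (h : A ⟶ B) (v : Point B) (a : A.carrier) :
    v.comap h a = v (h.toHeytingHom a) := rfl

theorem Point.continuous_comap (h : A ⟶ B) : Continuous (Point.comap h) :=
  continuous_of_eval fun a => isLocallyConstant_eval (h.toHeytingHom a)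

variable [Nontrivial L]

theorem Point.isClopen_setOf_successors_subset {U : Set (Point A)} (hU : IsClopen U) :
    IsClopen {v : Point A | v.successors ⊆ U} := by
  obtain ⟨c, hc₁, hc₂⟩ := exists_eq_indicator hU
  have : {v : Point A | v.successors ⊆ U} = {v | v (A.box c) = ⊤} := by
    ext v
    rw [Set.mem_ofPred_eq, Set.mem_ofPred_eq, ← top_le_iff, le_map_box_iff]
    refine ⟨fun h w hw => (hc₁ w (h hw)).ge, fun h w hw => ?_⟩
    by_contra hwU
    exact bot_ne_top ((hc₂ w hwU).symm.trans (top_unique (h w hw)))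
  rw [this]
  exact (isLocallyConstant_eval _).isClopen_fiber ⊤

/-- The image of the successors of `v` is closed, so that a point `w` outside it is separated from
it by an element `c`. Then `v (h (□ c)) = ⊤` and `w` is not a successor of `v.comap h`. -/
theorem Point.image_successors (h : A ⟶ B) (v : Point B) :
    Point.comap h '' v.successors = (v.comap h).successors := by
  refine Set.Subset.antisymm ?_ fun w hw => ?_
  · rintro _ ⟨w, hw, rfl⟩ a
    rw [comap_apply, comap_apply, h.map_box]
    exact hw _
  · have hcl : IsClosed (Point.comap h '' v.successors) :=
      (v.isClosed_successors.isCompact.image (continuous_comap h)).isClosed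
    by_contra hw'
    obtain ⟨U, hU, hwU, hUc⟩ :=
      isTopologicalBasis_isClopen.exists_subset_of_mem_open (show w ∈ _ᶜ from hw') hcl.isOpen_compl
    obtain ⟨c, hc₁, hc₂⟩ := exists_eq_indicator (IsClopen.compl hU)
    have htop : ⊤ ≤ v.comap h (A.box c) := by
      rw [comap_apply, h.map_box, le_map_box_iff]
      intro u hu
      exact (hc₁ (u.comap h) fun huU => hUc huU ⟨u, hu, rfl⟩).ge
    exact bot_ne_top ((hc₂ w fun hwc => hwc hwU).symm.trans (top_unique (htop.trans (hw c))))

/-- The `L`-valued pairwise Boolean space of the points of `A`. Its two topologies are equal, and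
the subalgebra `M` is assigned the set of the points with values in `M`. -/
def spectrum (A : MLAlg L) : PBSL L where
  carrier := Point A
  τ₁ := inferInstance
  τ₂ := inferInstance
  pairwiseBoolean := .of_isTopologicalBasis_isClopen Point.isTopologicalBasis_isClopen
  α M := {v | Set.range v ⊆ M.carrier}
  α_closed M := by
    have : IsClosed {v : Point A | Set.range v ⊆ M.carrier} := by
      simp only [Set.range_subset_iff, Set.ofPred_forall]
      exact isClosed_iInter fun a => Point.isClosed_setOf_eval_mem a _
    exact ⟨this, this⟩
  α_top := Set.eq_univ_of_forall fun _ => Set.subset_univ _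
  α_inf _ _ := Set.ext fun _ => Set.subset_inter_iff

theorem Point.continuous_successors : Continuous[(spectrum A).τ₁, vietoris₁ _ _]
    (fun v : Point A => (⟨v.successors, v.isClosed_successors, v.isClosed_successors⟩ :
      PClosed (spectrum A).τ₁ (spectrum A).τ₂)) := by
  refine continuous_generateFrom_iff.2 ?_
  rintro _ (⟨U, hU, rfl⟩ | ⟨U, hU, rfl⟩)
  · exact (isClopen_setOf_successors_subset (PairwiseBoolean.mem_bβ.1 hU)).2
  · have hU' : IsClopen (X := Point A) U := PairwiseBoolean.mem_bβ.1 hU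
    rw [← compl_compl U, ← compl_boxSet]
    exact (isClopen_setOf_successors_subset hU'.compl).compl.2

/-- The canonical coalgebra on the space of points, sending a point to the set of the points
accessible from it. -/
def spectrumCoalgebra (A : MLAlg L) : Endofunctor.Coalgebra (biVietoris L) where
  V := spectrum A
  str :=
    { toFun := fun v => ⟨v.successors, v.isClosed_successors, v.isClosed_successors⟩
      continuous₁ := Point.continuous_successors
      continuous₂ := Point.continuous_successors
      map_α := fun _ _ hv _ hw => (Point.range_subset_of_mem_successors hw).trans hv }

/-- The functor sending an algebra to its canonical coalgebra. -/
def spectrumFunctor (L : Type u) [HeytingAlgebra L] [Fintype L] [Nontrivial L] :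
    (MLAlg L)ᵒᵖ ⥤ Endofunctor.Coalgebra (biVietoris L) where
  obj A := spectrumCoalgebra A.unop
  map h :=
    { f :=
        { toFun := Point.comap h.unop
          continuous₁ := Point.continuous_comap h.unop
          continuous₂ := Point.continuous_comap h.unop
          map_α := by
            rintro M v hv _ ⟨a, rfl⟩
            exact hv ⟨_, rfl⟩ }
      h := PBSLHom.ext (funext fun v => Subtype.ext (Point.image_successors h.unop v)) }

end Spectrum

/-! ### Full faithfulness -/

section FullyFaithful

variable {L : Type u} [HeytingAlgebra L]

/-- The topology of a pairwise Boolean space, the first one by choice, since both are equal. -/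
instance (X : PBSL L) : TopologicalSpace X.carrier := X.τ₁

/-- The functions `f : X → L` that are arrows of `PBS_L`, for the discrete topologies on `L` and the
assignment of the set `M` to each subalgebra `M`. -/
structure IsAdmissible (X : PBSL L) (f : X.carrier → L) : Prop where
  isLocallyConstant : IsLocallyConstant f
  mem : ∀ M, ∀ x ∈ X.α M, f x ∈ M.carrier

theorem IsAdmissible.comp {X Y : PBSL L} {f : Y.carrier → L} (hf : IsAdmissible Y f) (g : X ⟶ Y) :
    IsAdmissible X (f ∘ g.toFun) :=
  ⟨hf.isLocallyConstant.comp_continuous g.continuous₁, fun M x hx => hf.mem M _ (g.map_α M x hx)⟩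

variable [Fintype L] [Nontrivial L] {A B : MLAlg L}

theorem isAdmissible_eval (a : A.carrier) : IsAdmissible (spectrum A) fun v : Point A => v a :=
  ⟨Point.isLocallyConstant_eval a, fun _ _ hv => hv ⟨a, rfl⟩⟩

theorem IsAdmissible.exists_eval_eq {g : Point A → L} (hg : IsAdmissible (spectrum A) g) :
    ∃ a : A.carrier, ∀ v : Point A, v a = g v :=
  Point.exists_eval_eq hg.isLocallyConstant fun v => hg.mem v.range v (Set.Subset.refl _)

/-- The underlying map of a morphism of canonical coalgebras. -/
def pointMap (f : spectrumCoalgebra B ⟶ spectrumCoalgebra A) : Point B → Point A :=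
  f.f.toFun

theorem successors_pointMap (f : spectrumCoalgebra B ⟶ spectrumCoalgebra A) (v : Point B) :
    (pointMap f v).successors = pointMap f '' v.successors :=
  (congrArg Subtype.val (congrFun (congrArg PBSLHom.toFun f.h) v)).symm

theorem exists_eval_eq_of_hom (f : spectrumCoalgebra B ⟶ spectrumCoalgebra A) (a : A.carrier) :
    ∃ b : B.carrier, ∀ v : Point B, v b = pointMap f v a :=
  ((isAdmissible_eval a).comp f.f).exists_eval_eq

/-- The homomorphism inducing a given coalgebra morphism `f`: it sends `a` to the element
representing the function `v ↦ f v a`. -/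
noncomputable def homOfCoalgebraHom (f : spectrumCoalgebra B ⟶ spectrumCoalgebra A) : A ⟶ B :=
  have hv (a : A.carrier) (v : Point B) :
      v (exists_eval_eq_of_hom f a).choose = pointMap f v a :=
    (exists_eval_eq_of_hom f a).choose_spec v
  { toHeytingHom :=
      { toFun := fun a => (exists_eval_eq_of_hom f a).choose
        map_sup' := fun a b => B.ext_point fun v => by
          rw [map_sup, hv, hv, hv, map_sup]
        map_inf' := fun a b => B.ext_point fun v => by
          rw [map_inf, hv, hv, hv, map_inf]
        map_bot' := B.ext_point fun v => by
          rw [hv, map_bot, map_bot]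
        map_himp' := fun a b => B.ext_point fun v => by
          rw [map_himp, hv, hv, hv, map_himp] }
    map_T := fun l a => B.ext_point fun v => by
      change v (exists_eval_eq_of_hom f (A.T l a)).choose =
        v (B.T l (exists_eval_eq_of_hom f a).choose)
      rw [v.map_T, hv, hv, Point.map_T]
    map_box := fun a => B.ext_point fun v => by
      change v (exists_eval_eq_of_hom f (A.box a)).choose =
        v (B.box (exists_eval_eq_of_hom f a).choose)
      rw [hv]
      refine eq_of_forall_le_iff fun l => ?_
      rw [Point.le_map_box_iff, Point.le_map_box_iff, successors_pointMap]
      simp only [Set.forall_mem_image, hv] }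

theorem apply_homOfCoalgebraHom (f : spectrumCoalgebra B ⟶ spectrumCoalgebra A) (v : Point B)
    (a : A.carrier) : v ((homOfCoalgebraHom f).toHeytingHom a) = pointMap f v a :=
  (exists_eval_eq_of_hom f a).choose_spec v

instance : (spectrumFunctor L).Faithful where
  map_injective {A B} h k hhk := by
    have hv : ∀ v : Point A.unop, v.comap h.unop = v.comap k.unop := fun v =>
      congrFun (congrArg (fun m => PBSLHom.toFun (Endofunctor.Coalgebra.Hom.f m)) hhk) v
    refine Quiver.Hom.unop_inj (MLHom.ext (DFunLike.ext _ _ fun b => ?_))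
    exact A.unop.ext_point fun v => DFunLike.congr_fun (hv v) b

instance : (spectrumFunctor L).Full where
  map_surjective f := by
    refine ⟨(homOfCoalgebraHom f).op, Endofunctor.Coalgebra.ext (PBSLHom.ext (funext fun v => ?_))⟩
    exact DFunLike.ext (F := Point _) _ _ fun b => apply_homOfCoalgebraHom f v b

end FullyFaithful

/-! ### Algebras separated by homomorphisms to `L` -/

section Transfer

variable {L : Type u} [HeytingAlgebra L] [Fintype L]

theorem isVLAlgebra_truthT [Nontrivial L] : IsVLAlgebra L (truthT : L → L → L) := by
  have hbin : ∀ (g : L → L → L) (l₁ l₂ a b : L),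
      truthT l₁ a ⊓ truthT l₂ b ≤ truthT (g l₁ l₂) (g a b) := by
    intro g l₁ l₂ a b
    by_cases h₁ : a = l₁
    · by_cases h₂ : b = l₂
      · rw [h₁, h₂, truthT_self (g l₁ l₂)]
        exact le_top
      · simp [truthT_of_ne h₂]
    · simp [truthT_of_ne h₁]
  exact
  { T_himp := hbin (· ⇨ ·)
    T_inf := hbin (· ⊓ ·)
    T_sup := hbin (· ⊔ ·)
    T_T := fun l₁ l₂ a => by
      by_cases h : a = l₂
      · rw [h, truthT_self (truthT l₁ l₂)]
        exact le_top
      · simp [truthT_of_ne h]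
    T_bot_bot := truthT_self _
    T_bot := fun l hl => truthT_of_ne hl.symm
    T_top_top := truthT_self _
    T_top := fun l hl => truthT_of_ne hl.symm
    T_cover := fun a => top_unique <| by
      rw [← truthT_self a]
      exact Finset.le_sup (f := fun l => truthT l a) (Finset.mem_univ a)
    T_em := fun l a => by by_cases h : a = l <;> simp [truthT, h]
    T_disjoint := fun l₁ l₂ a hne => by
      by_cases h : a = l₁
      · rw [truthT_of_ne (h ▸ hne : a ≠ l₂), inf_bot_eq]
      · rw [truthT_of_ne h, bot_inf_eq]
    T_top_T := fun l a => by by_cases h : a = l <;> simp [truthT, h]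
    T_bot_T := fun l a => by by_cases h : a = l <;> simp [truthT, h]
    T_mid_T := fun l₁ l₂ a h₀ h₁ => by
      by_cases h : a = l₁ <;> simp [truthT, h, h₀.symm, h₁.symm]
    T_top_le := fun a => by by_cases h : a = ⊤ <;> simp [truthT, h]
    T_top_inf := fun a b => by
      by_cases h : a = ⊤ <;> by_cases h' : b = ⊤ <;> simp [truthT, h, h']
    T_ext := fun a b => by
      by_cases h : a = b
      · simp [h]
      · refine (Finset.inf_le (Finset.mem_univ a)).trans ?_
        rw [truthT_self, truthT_of_ne (Ne.symm h)]
        simp }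

/-- The axioms of `L`-`VL`-algebras hold in every algebra that embeds into a power of `L`. -/
theorem IsVLAlgebra.of_separating [Nontrivial L] {A : Type u} [HeytingAlgebra A] {T : L → A → A}
    {ι : Type*} (e : ι → HeytingHom A L) (he : ∀ {a b : A}, (∀ i, e i a = e i b) → a = b)
    (hT : ∀ i l a, e i (T l a) = truthT l (e i a)) : IsVLAlgebra L T := by
  have hle : ∀ {a b : A}, (∀ i, e i a ≤ e i b) → a ≤ b := fun h =>
    inf_eq_left.1 (he fun i => by rw [map_inf, inf_eq_left.2 (h i)])
  have hL := isVLAlgebra_truthT (L := L)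
  constructor
  · exact fun l₁ l₂ a b => hle fun i => by
      simpa only [map_inf, map_himp, hT] using hL.T_himp l₁ l₂ (e i a) (e i b)
  · exact fun l₁ l₂ a b => hle fun i => by
      simpa only [map_inf, hT] using hL.T_inf l₁ l₂ (e i a) (e i b)
  · exact fun l₁ l₂ a b => hle fun i => by
      simpa only [map_inf, map_sup, hT] using hL.T_sup l₁ l₂ (e i a) (e i b)
  · exact fun l₁ l₂ a => hle fun i => by
      simpa only [hT] using hL.T_T l₁ l₂ (e i a)
  · exact he fun i => by simpa only [hT, map_bot, map_top] using hL.T_bot_bot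
  · exact fun l hl => he fun i => by simpa only [hT, map_bot] using hL.T_bot l hl
  · exact he fun i => by simpa only [hT, map_top] using hL.T_top_top
  · exact fun l hl => he fun i => by simpa only [hT, map_bot, map_top] using hL.T_top l hl
  · exact fun a => he fun i => by
      simpa only [map_finset_sup, Function.comp_def, hT, map_top] using hL.T_cover (e i a)
  · exact fun l a => he fun i => by
      simpa only [map_sup, map_himp, map_bot, map_top, hT] using hL.T_em l (e i a)
  · exact fun l₁ l₂ a h => he fun i => by
      simpa only [map_inf, map_bot, hT] using hL.T_disjoint l₁ l₂ (e i a) h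
  · exact fun l a => he fun i => by simpa only [hT] using hL.T_top_T l (e i a)
  · exact fun l a => he fun i => by
      simpa only [hT, map_himp, map_bot] using hL.T_bot_T l (e i a)
  · exact fun l₁ l₂ a h h' => he fun i => by
      simpa only [hT, map_bot] using hL.T_mid_T l₁ l₂ (e i a) h h'
  · exact fun a => hle fun i => by simpa only [hT] using hL.T_top_le (e i a)
  · exact fun a b => he fun i => by
      simpa only [hT, map_inf] using hL.T_top_inf (e i a) (e i b)
  · exact fun a b => hle fun i => by
      simpa only [hT, map_finset_inf, Function.comp_def, map_bihimp] using hL.T_ext (e i a) (e i b)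

end Transfer

/-! ### The topology of `L`-valued pairwise Boolean spaces -/

section PBSLTopology

variable {L : Type u} [HeytingAlgebra L]

theorem PBSL.mem_bβ_iff (X : PBSL L) {U : Set X.carrier} : U ∈ bβ X.τ₁ X.τ₂ ↔ IsClopen U := by
  rw [← X.pairwiseBoolean.eq]
  exact PairwiseBoolean.mem_bβ

instance (X : PBSL L) : CompactSpace X.carrier := by
  have h := X.pairwiseBoolean
  rw [← h.eq] at h
  exact h.compactSpace

theorem PBSL.exists_isClopen_subset (X : PBSL L) {U : Set X.carrier} (hU : IsOpen U)
    {x : X.carrier} (hx : x ∈ U) : ∃ V, IsClopen V ∧ x ∈ V ∧ V ⊆ U := by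
  obtain ⟨V, hV, hxV, hVU⟩ := X.pairwiseBoolean.zeroDim₁.exists_subset_of_mem_open hx hU
  exact ⟨V, X.mem_bβ_iff.1 hV, hxV, hVU⟩

theorem PBSL.isClopen_boxSet (X : PBSL L) {U : Set X.carrier} (hU : IsClopen U) :
    IsClopen (X := (biVietorisObj X).carrier) (boxSet X.τ₁ X.τ₂ U) := by
  refine ⟨⟨?_⟩, ?_⟩
  · exact TopologicalSpace.isOpen_generateFrom_of_mem
      (Or.inr ⟨_, X.mem_bβ_iff.2 hU.compl, (compl_boxSet X.τ₁ X.τ₂ U).symm⟩)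
  · exact TopologicalSpace.isOpen_generateFrom_of_mem (Or.inl ⟨_, X.mem_bβ_iff.2 hU, rfl⟩)

/-- Since the two topologies of a pairwise Boolean space are equal, continuity for the first
topologies is enough for an arrow. -/
def PBSLHom.ofContinuous {X Y : PBSL L} (f : X.carrier → Y.carrier) (hf : Continuous f)
    (hα : ∀ M, ∀ x ∈ X.α M, f x ∈ Y.α M) : PBSLHom X Y where
  toFun := f
  continuous₁ := hf
  continuous₂ := by
    rw [← X.pairwiseBoolean.eq, ← Y.pairwiseBoolean.eq]
    exact hf
  map_α := hα

/-- Among the subalgebras `M` with `x ∈ α M` there is a least one, as `L` is finite and `α`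
preserves binary meets. -/
theorem PBSL.exists_least_subAlg [Finite L] (X : PBSL L) (x : X.carrier) :
    ∃ M, x ∈ X.α M ∧ ∀ N, x ∈ X.α N → M.carrier ⊆ N.carrier := by
  obtain ⟨M, hM, hmin⟩ := (measure fun M : SubAlg L => M.carrier.ncard).wf.has_min
    {M | x ∈ X.α M} ⟨⊤, by rw [Set.mem_ofPred_eq, X.α_top]; trivial⟩
  refine ⟨M, hM, fun N hN => ?_⟩
  have hMN : x ∈ X.α (M ⊓ N) := by
    rw [X.α_inf]
    exact ⟨hM, hN⟩
  have := Set.eq_of_subset_of_ncard_le (s := (M ⊓ N).carrier) (t := M.carrier)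
    Set.inter_subset_left (not_lt.1 (hmin _ hMN)) (Set.toFinite _)
  exact Set.inter_eq_left.1 this

instance [Finite L] : Finite (SubAlg L) :=
  Finite.of_injective SubAlg.carrier fun _ _ => SubAlg.ext

end PBSLTopology

/-! ### The algebra of admissible functions -/

section AdmissibleFunctions

variable {L : Type u} [HeytingAlgebra L] {X : PBSL L}

theorem SubAlg.compl_mem (M : SubAlg L) {a : L} (ha : a ∈ M.carrier) : aᶜ ∈ M.carrier := by
  rw [← himp_bot]
  exact M.himp_mem ha M.bot_mem

theorem SubAlg.truthT_mem (M : SubAlg L) (l x : L) : truthT l x ∈ M.carrier := by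
  by_cases h : x = l
  · rw [h, truthT_self]
    exact M.top_mem
  · rw [truthT_of_ne h]
    exact M.bot_mem

namespace IsAdmissible

theorem comp_left {f : X.carrier → L} (hf : IsAdmissible X f) (g : L → L)
    (hg : ∀ M : SubAlg L, ∀ a ∈ M.carrier, g a ∈ M.carrier) :
    IsAdmissible X fun x => g (f x) :=
  ⟨hf.isLocallyConstant.comp g, fun M x hx => hg M _ (hf.mem M x hx)⟩

theorem comp₂ {f f' : X.carrier → L} (hf : IsAdmissible X f) (hf' : IsAdmissible X f')
    (g : L → L → L)
    (hg : ∀ M : SubAlg L, ∀ a ∈ M.carrier, ∀ b ∈ M.carrier, g a b ∈ M.carrier) :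
    IsAdmissible X fun x => g (f x) (f' x) :=
  ⟨hf.isLocallyConstant.comp₂ hf'.isLocallyConstant g,
    fun M x hx => hg M _ (hf.mem M x hx) _ (hf'.mem M x hx)⟩

theorem const {l : L} (hl : ∀ M : SubAlg L, l ∈ M.carrier) : IsAdmissible X fun _ => l :=
  ⟨IsLocallyConstant.const l, fun M _ _ => hl M⟩

open Classical in
/-- Two values can be prescribed on a clopen set and its complement, if the first one lies in all
subalgebras that are assigned a set meeting the clopen set, and the second one in all
subalgebras. -/
theorem ite {V : Set X.carrier} (hV : IsClopen V) {l l' : L}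
    (hl : ∀ M, ∀ x ∈ X.α M, x ∈ V → l ∈ M.carrier) (hl' : ∀ M : SubAlg L, l' ∈ M.carrier) :
    IsAdmissible X fun x => if x ∈ V then l else l' := by
  refine ⟨(IsLocallyConstant.iff_eventually_eq _).2 fun x => ?_, fun M x hx => ?_⟩
  · by_cases h : x ∈ V
    · filter_upwards [hV.2.mem_nhds h] with y hy
      simp [h, hy]
    · filter_upwards [hV.1.isOpen_compl.mem_nhds h] with y hy
      simp [h, Set.notMem_of_mem_compl hy]
  · by_cases h : x ∈ V
    · simpa [h] using hl M x hx h
    · simpa [h] using hl' M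

end IsAdmissible

/-- The set of the admissible functions on `X`, an algebra with pointwise operations. -/
def AdmissibleFun (X : PBSL L) : Type u := {f : X.carrier → L // IsAdmissible X f}

namespace AdmissibleFun

instance : FunLike (AdmissibleFun X) X.carrier L where
  coe f := f.1
  coe_injective := Subtype.val_injective

instance : Max (AdmissibleFun X) :=
  ⟨fun f g => ⟨_, f.2.comp₂ g.2 (· ⊔ ·) fun M _ ha _ hb => M.sup_mem ha hb⟩⟩

instance : Min (AdmissibleFun X) :=
  ⟨fun f g => ⟨_, f.2.comp₂ g.2 (· ⊓ ·) fun M _ ha _ hb => M.inf_mem ha hb⟩⟩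

instance : HImp (AdmissibleFun X) :=
  ⟨fun f g => ⟨_, f.2.comp₂ g.2 (· ⇨ ·) fun M _ ha _ hb => M.himp_mem ha hb⟩⟩

instance : Compl (AdmissibleFun X) :=
  ⟨fun f => ⟨_, f.2.comp_left (·ᶜ) fun M _ ha => M.compl_mem ha⟩⟩

instance : Top (AdmissibleFun X) := ⟨⟨_, .const SubAlg.top_mem⟩⟩

instance : Bot (AdmissibleFun X) := ⟨⟨_, .const SubAlg.bot_mem⟩⟩

instance : LE (AdmissibleFun X) := ⟨fun f g => f.1 ≤ g.1⟩

instance : LT (AdmissibleFun X) := ⟨fun f g => f.1 < g.1⟩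

instance : HeytingAlgebra (AdmissibleFun X) :=
  Function.Injective.heytingAlgebra (fun f : AdmissibleFun X => f.1) Subtype.val_injective Iff.rfl
    Iff.rfl (fun _ _ => rfl) (fun _ _ => rfl) rfl rfl (fun _ => rfl) (fun _ _ => rfl)

/-- Evaluation of admissible functions at `x`. -/
def eval (x : X.carrier) : HeytingHom (AdmissibleFun X) L where
  toFun f := f x
  map_sup' _ _ := rfl
  map_inf' _ _ := rfl
  map_bot' := rfl
  map_himp' _ _ := rfl

theorem eval_apply (x : X.carrier) (f : AdmissibleFun X) : eval x f = f x := rfl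

theorem inf_apply (f g : AdmissibleFun X) (x : X.carrier) : (f ⊓ g) x = f x ⊓ g x := rfl

theorem ext_eval {f g : AdmissibleFun X} (h : ∀ x, eval x f = eval x g) : f = g :=
  Subtype.ext (funext h)

/-- The operation `T_l`, applied pointwise. -/
noncomputable def T (l : L) (f : AdmissibleFun X) : AdmissibleFun X :=
  ⟨_, f.2.comp_left (truthT l) fun M _ _ => M.truthT_mem _ _⟩

theorem opU_apply [Fintype L] (l : L) (f : AdmissibleFun X) (x : X.carrier) :
    opU T l f x = opU truthT l (f x) := by
  rw [← eval_apply]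
  simp only [opU, map_finset_sup]
  rfl

end AdmissibleFun

theorem PBSL.exists_admissibleFun_eq_bot_of_notMem (X : PBSL L) {C : Set X.carrier} (hC : IsClosed C)
    {x : X.carrier} (hx : x ∉ C) : ∃ f : AdmissibleFun X, f x = ⊥ ∧ ∀ y ∈ C, f y = ⊤ := by
  classical
  obtain ⟨V, hV, hxV, hVC⟩ := X.exists_isClopen_subset hC.isOpen_compl hx
  refine ⟨⟨_, .ite hV (fun M _ _ _ => M.bot_mem) SubAlg.top_mem⟩, if_pos hxV, fun y hy => if_neg ?_⟩
  exact fun hyV => hVC hyV hy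

end AdmissibleFunctions

/-! ### The algebra of a coalgebra -/

section DualAlgebra

variable {L : Type u} [HeytingAlgebra L]

variable (ξ : Endofunctor.Coalgebra (biVietoris L))

/-- The closed set of the successors of `x` in a coalgebra. -/
def succSet (x : ξ.V.carrier) : Set ξ.V.carrier := (ξ.str.toFun x : PClosed ξ.V.τ₁ ξ.V.τ₂).1

theorem isClosed_succSet (x : ξ.V.carrier) : IsClosed (succSet ξ x) :=
  (ξ.str.toFun x : PClosed ξ.V.τ₁ ξ.V.τ₂).2.1

theorem isClopen_setOf_succSet_subset {U : Set ξ.V.carrier} (hU : IsClopen U) :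
    IsClopen {x | succSet ξ x ⊆ U} :=
  (ξ.V.isClopen_boxSet hU).preimage ξ.str.continuous₁

variable [Fintype L]

open Classical in
/-- The infimum of a set of truth values. -/
noncomputable def truthInf (s : Set L) : L := (Finset.univ.filter (· ∈ s)).inf id

theorem le_truthInf_iff {s : Set L} {l : L} : l ≤ truthInf s ↔ ∀ m ∈ s, l ≤ m := by
  simp [truthInf, Finset.le_inf_iff]

theorem truthInf_mem (M : SubAlg L) {s : Set L} (hs : s ⊆ M.carrier) :
    truthInf s ∈ M.carrier := by
  classical
  refine Finset.inf_induction M.top_mem (fun _ ha _ hb => M.inf_mem ha hb) fun l hl => hs ?_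
  simpa using hl

theorem IsAdmissible.box {f : ξ.V.carrier → L} (hf : IsAdmissible ξ.V f) :
    IsAdmissible ξ.V fun x => truthInf (f '' succSet ξ x) := by
  refine ⟨(IsLocallyConstant.iff_eventually_eq _).2 fun x => ?_, fun M x hx => ?_⟩
  -- A truth value is determined by the finitely many truth values below it.
  · have : ∀ l, ∀ᶠ y in 𝓝 x,
        (l ≤ truthInf (f '' succSet ξ y) ↔ l ≤ truthInf (f '' succSet ξ x)) := fun l => by
      have hcl := isClopen_setOf_succSet_subset ξ
        (hf.isLocallyConstant.comp (l ≤ ·) |>.isClopen_fiber True)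
      have hiff : ∀ y, y ∈ {x | succSet ξ x ⊆ {x | ((l ≤ ·) ∘ f) x = True}} ↔
          l ≤ truthInf (f '' succSet ξ y) := fun y => by
        simp only [le_truthInf_iff, Set.forall_mem_image, Set.mem_ofPred_eq, Set.subset_def,
          Function.comp_apply, eq_iff_iff, iff_true]
      by_cases h : l ≤ truthInf (f '' succSet ξ x)
      · filter_upwards [hcl.2.mem_nhds ((hiff x).2 h)] with y hy
        exact iff_of_true ((hiff y).1 hy) h
      · filter_upwards [hcl.1.isOpen_compl.mem_nhds (fun h' => h ((hiff x).1 h'))] with y hy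
        exact iff_of_false (fun h' => hy ((hiff y).2 h')) h
    filter_upwards [Filter.eventually_all.2 this] with y hy
    exact eq_of_forall_le_iff hy
  · refine truthInf_mem M ?_
    rintro _ ⟨y, hy, rfl⟩
    exact hf.mem M y (ξ.str.map_α M x hx hy)

/-- The operation `□` on admissible functions: `□ f` sends `x` to the infimum of `f` on the
successors of `x`. -/
noncomputable def AdmissibleFun.box (f : AdmissibleFun ξ.V) : AdmissibleFun ξ.V :=
  ⟨_, f.2.box ξ⟩

theorem AdmissibleFun.le_box_apply_iff {f : AdmissibleFun ξ.V} {x : ξ.V.carrier} {l : L} :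
    l ≤ AdmissibleFun.box ξ f x ↔ ∀ y ∈ succSet ξ x, l ≤ f y :=
  le_truthInf_iff.trans Set.forall_mem_image

variable [Nontrivial L]

/-- The algebra of the admissible functions on a coalgebra. -/
noncomputable def dualAlgebra : MLAlg L where
  carrier := AdmissibleFun ξ.V
  T := AdmissibleFun.T
  isVLAlgebra := .of_separating AdmissibleFun.eval AdmissibleFun.ext_eval fun _ _ _ => rfl
  box := AdmissibleFun.box ξ
  box_inf f g := DFunLike.ext _ _ fun x => eq_of_forall_le_iff fun l => by
    simp only [AdmissibleFun.inf_apply, le_inf_iff, AdmissibleFun.le_box_apply_iff, ← forall₂_and]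
  box_U l f := DFunLike.ext _ _ fun x => by
    rw [AdmissibleFun.opU_apply]
    by_cases h : l ≤ AdmissibleFun.box ξ f x
    · rw [opU_truthT_of_le h]
      refine top_unique ((AdmissibleFun.le_box_apply_iff ξ).2 fun y hy => ?_)
      rw [AdmissibleFun.opU_apply,
        opU_truthT_of_le ((AdmissibleFun.le_box_apply_iff ξ).1 h y hy)]
    · rw [opU_truthT_of_not_le h, eq_bot_iff]
      simp only [AdmissibleFun.le_box_apply_iff, not_forall] at h
      obtain ⟨y, hy, hly⟩ := h
      rw [← opU_truthT_of_not_le hly, ← AdmissibleFun.opU_apply]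
      exact (AdmissibleFun.le_box_apply_iff ξ).1 le_rfl y hy

/-- Evaluation at an element of a coalgebra, as a point of the dual algebra. -/
noncomputable def evalPoint (x : ξ.V.carrier) : Point (dualAlgebra ξ) :=
  ⟨AdmissibleFun.eval x, fun _ _ => rfl⟩

theorem continuous_evalPoint : Continuous (evalPoint ξ) :=
  Point.continuous_of_eval fun f => f.2.isLocallyConstant

theorem evalPoint_injective : Function.Injective (evalPoint ξ) := by
  intro x y hxy
  by_contra hne
  have := ξ.V.pairwiseBoolean
  rw [← this.eq] at this
  have := this.t2Space
  obtain ⟨f, hfx, hfy⟩ := ξ.V.exists_admissibleFun_eq_bot_of_notMem (isClosed_singleton (x := y)) hne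
  refine bot_ne_top (α := L) ?_
  rw [← hfx, ← hfy y rfl]
  exact DFunLike.congr_fun hxy f

/-- The image of the evaluation map is closed. A point outside it would be separated from it by a
nonzero element of the dual algebra that is zero as a function. -/
theorem evalPoint_surjective : Function.Surjective (evalPoint ξ) := by
  intro v
  by_contra hv
  obtain ⟨U, hU, hvU, hUc⟩ := Point.isTopologicalBasis_isClopen.exists_subset_of_mem_open
    (show v ∈ (Set.range (evalPoint ξ))ᶜ from hv)
    (isCompact_range (continuous_evalPoint ξ)).isClosed.isOpen_compl
  obtain ⟨c, hc₁, hc₂⟩ := Point.exists_eq_indicator hU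
  have hc : c = ⊥ := AdmissibleFun.ext_eval fun x =>
    (hc₂ (evalPoint ξ x) fun hx => hUc hx ⟨x, rfl⟩).trans (map_bot (AdmissibleFun.eval x)).symm
  have := hc₁ v hvU
  rw [hc, map_bot] at this
  exact bot_ne_top this

theorem range_evalPoint_subset_iff {x : ξ.V.carrier} {M : SubAlg L} :
    Set.range (evalPoint ξ x) ⊆ M.carrier ↔ x ∈ ξ.V.α M := by
  classical
  refine ⟨fun h => ?_, ?_⟩
  -- The function equal to `l` near `x` and `⊥` elsewhere is admissible for all `l` in the least
  -- subalgebra `N` assigned a set containing `x`, so that `N ⊆ M`.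
  · obtain ⟨N, hN, hmin⟩ := ξ.V.exists_least_subAlg x
    have hcl : IsClosed (⋃ K ∈ {K | x ∉ ξ.V.α K}, ξ.V.α K) :=
      (Set.toFinite _).isClosed_biUnion fun K _ => (ξ.V.α_closed K).1
    obtain ⟨V, hV, hxV, hVc⟩ := ξ.V.exists_isClopen_subset hcl.isOpen_compl (x := x) (by simp)
    have hNM : N.carrier ⊆ M.carrier := fun l hl => by
      refine h ⟨(⟨_, .ite hV (l := l) (l' := ⊥) (fun K y hy hyV => ?_) SubAlg.bot_mem⟩ :
        AdmissibleFun ξ.V), if_pos hxV⟩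
      by_contra hlK
      exact hVc hyV (Set.mem_biUnion (show x ∉ ξ.V.α K from fun hxK => hlK (hmin K hxK hl)) hy)
    have : N ⊓ M = N := SubAlg.ext (Set.inter_eq_left.2 hNM)
    have hα := ξ.V.α_inf N M
    rw [this] at hα
    exact (hα ▸ hN).2
  · rintro hx _ ⟨f, rfl⟩
    exact f.2.mem M x hx

theorem image_succSet (x : ξ.V.carrier) :
    evalPoint ξ '' succSet ξ x = (evalPoint ξ x).successors := by
  refine Set.Subset.antisymm ?_ fun w hw => ?_
  · rintro _ ⟨y, hy, rfl⟩ f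
    exact (AdmissibleFun.le_box_apply_iff ξ).1 le_rfl y hy
  · obtain ⟨y, rfl⟩ := evalPoint_surjective ξ w
    refine ⟨y, ?_, rfl⟩
    by_contra hy
    obtain ⟨f, hfy, hf⟩ := ξ.V.exists_admissibleFun_eq_bot_of_notMem (isClosed_succSet ξ x) hy
    have hle : AdmissibleFun.box ξ f x ≤ f y := hw f
    rw [hfy] at hle
    exact top_ne_bot (le_bot_iff.1
      (((AdmissibleFun.le_box_apply_iff ξ).2 fun z hz => (hf z hz).ge).trans hle))

/-- The evaluation map as a homeomorphism. -/
noncomputable def evalHomeomorph : ξ.V.carrier ≃ₜ Point (dualAlgebra ξ) :=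
  (continuous_evalPoint ξ).homeoOfEquivCompactToT2
    (f := Equiv.ofBijective _ ⟨evalPoint_injective ξ, evalPoint_surjective ξ⟩)

/-- Every coalgebra is isomorphic to the canonical coalgebra of its dual algebra. -/
noncomputable def evalIso : ξ ≅ spectrumCoalgebra (dualAlgebra ξ) :=
  Endofunctor.Coalgebra.isoMk
    { hom := PBSLHom.ofContinuous (Y := spectrum (dualAlgebra ξ)) (evalHomeomorph ξ)
        (evalHomeomorph ξ).continuous fun _ _ hx => (range_evalPoint_subset_iff ξ).2 hx
      inv := PBSLHom.ofContinuous (X := spectrum (dualAlgebra ξ)) (evalHomeomorph ξ).symm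
        (evalHomeomorph ξ).symm.continuous fun M v hv => by
          obtain ⟨x, rfl⟩ := (evalHomeomorph ξ).surjective v
          rw [Homeomorph.symm_apply_apply]
          exact (range_evalPoint_subset_iff ξ).1 hv
      hom_inv_id := PBSLHom.ext (funext (evalHomeomorph ξ).symm_apply_apply)
      inv_hom_id := PBSLHom.ext (funext (evalHomeomorph ξ).apply_symm_apply) }
    (PBSLHom.ext (funext fun x => Subtype.ext (image_succSet ξ x)))

instance : (spectrumFunctor L).EssSurj where
  mem_essImage ξ := ⟨Opposite.op (dualAlgebra ξ), ⟨(evalIso ξ).symm⟩⟩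

end DualAlgebra

end FittingDuality

/-- For a nontrivial finite Heyting algebra (i.e. finite distributive lattice) `L`, the category
of `L`-`ML`-algebras is dually equivalent to the category of coalgebras for the `L`-biVietoris
functor. -/
theorem theorem6 (L : Type u) [HeytingAlgebra L] [Fintype L] [Nontrivial L] :
    Nonempty ((FittingDuality.MLAlg L)ᵒᵖ ≌
      Endofunctor.Coalgebra (FittingDuality.biVietoris L)) := by
  have : (FittingDuality.spectrumFunctor L).IsEquivalence := { }
  exact ⟨(FittingDuality.spectrumFunctor L).asEquivalence⟩
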